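/- Let $N\ge 3$, let $\lambda>0$, and let $\rho:\mathbb R^N\to\mathbb R$ be a measurable function with $\rho\ge 0$. For $u\in W^{1,1}_{\mathrm{loc}}(\mathbb R^N)$ (real-valued, identified up to equality almost everywhere) put $$\|u\|_{E}=\left(\int_{\mathbb R^N}\big(|\nabla u|^2+u^2\big)\,dx+\lambda\left(\int_{\mathbb R^N}\int_{\mathbb R^N}\frac{u^2(x)\rho(x)\,u^2(y)\rho(y)}{|x-y|^{N-2}}\,dx\,dy\right)^{1/2}\right)^{1/2}\in[0,\infty],$$ where $\nabla u$ is the weak gradient, and let $E(\mathbb R^N)=\{u\in W^{1,1}_{\mathrm{loc}}(\mathbb R^N):\|u\|_{E}<\infty\}$. Then $E(\mathbb R^N)$ is a linear space, $\|\cdot\|_E$ is a norm on it, and with this norm $E(\mathbb R^N)$ is a separable Banach space. Moreover, if $E(\mathbb R^N)\neq\{0\}$, then $E(\mathbb R^N)$ admits a Markushevich basis: there are $e_m\in E(\mathbb R^N)$ and $e_m^*\in E(\mathbb R^N)^*$, $m\in\mathbb N$, such that $\langle e_n,e_m^*\rangle=\delta_{nm}$ for all $n,m\in\mathbb N$, the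 linear span of $\{e_m\}_{m\in\mathbb N}$ is dense in $E(\mathbb R^N)$, and the weak-* closure of the linear span of $\{e_m^*\}_{m\in\mathbb N}$ is $E(\mathbb R^N)^*$. -/

import Mathlib

open MeasureTheory
open scoped ENNReal ContDiff

noncomputable section

/-- `G` is a weak (distributional) gradient of `u` on `ℝ^N`:
`∫ u ∂ᵢφ = - ∫ Gᵢ φ` for all test functions `φ ∈ C_c^∞(ℝ^N)` and all `i`. -/
def HasWeakGradient {N : ℕ} (u : EuclideanSpace ℝ (Fin N) → ℝ)
    (G : EuclideanSpace ℝ (Fin N) → EuclideanSpace ℝ (Fin N)) : Prop :=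
  ∀ φ : EuclideanSpace ℝ (Fin N) → ℝ, ContDiff ℝ ∞ φ → HasCompactSupport φ →
    ∀ i : Fin N, ∫ x, u x * fderiv ℝ φ x (EuclideanSpace.single i 1) = - ∫ x, G x i * φ x

/-- `u ∈ W^{1,1}_loc(ℝ^N)`: `u` is locally integrable and has a locally integrable weak
gradient. -/
def MemW11loc {N : ℕ} (u : EuclideanSpace ℝ (Fin N) → ℝ) : Prop :=
  LocallyIntegrable u ∧
    ∃ G : EuclideanSpace ℝ (Fin N) → EuclideanSpace ℝ (Fin N),
      LocallyIntegrable G ∧ HasWeakGradient u G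

open Classical in
/-- The weak gradient `∇u` of `u ∈ W^{1,1}_loc(ℝ^N)` (unique up to a null set; the value is `0`,
and never used, if `u ∉ W^{1,1}_loc(ℝ^N)`). -/
def weakGradient {N : ℕ} (u : EuclideanSpace ℝ (Fin N) → ℝ) :
    EuclideanSpace ℝ (Fin N) → EuclideanSpace ℝ (Fin N) :=
  if h : MemW11loc u then h.2.choose else 0

/-- `∫ (|∇u|² + u²) dx`, as an element of `[0, ∞]`. -/
def sobolevEnergy {N : ℕ} (u : EuclideanSpace ℝ (Fin N) → ℝ) : ℝ≥0∞ :=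
  ∫⁻ x, ENNReal.ofReal (‖weakGradient u x‖ ^ 2 + u x ^ 2)

/-- `∫∫ u²(x) ρ(x) u²(y) ρ(y) / |x - y|^{N-2} dx dy`, as an element of `[0, ∞]`, for `N ≥ 3`.
The diagonal `x = y` is a null set, so the value of the integrand there is irrelevant. -/
def coulombEnergy {N : ℕ} (ρ u : EuclideanSpace ℝ (Fin N) → ℝ) : ℝ≥0∞ :=
  ∫⁻ y, ∫⁻ x, ENNReal.ofReal
    ((u x ^ 2 * ρ x * (u y ^ 2 * ρ y)) / ‖x - y‖ ^ ((N : ℝ) - 2))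

/-- The norm `‖u‖_E = (∫ (|∇u|² + u²) + lam (∫∫ …)^{1/2})^{1/2}`, as an element of `[0, ∞]`. -/
def eNormE {N : ℕ} (lam : ℝ) (ρ u : EuclideanSpace ℝ (Fin N) → ℝ) : ℝ≥0∞ :=
  (sobolevEnergy u + ENNReal.ofReal lam * coulombEnergy ρ u ^ (1 / 2 : ℝ)) ^ (1 / 2 : ℝ)

/-- `u ∈ E(ℝ^N)`: `u ∈ W^{1,1}_loc(ℝ^N)` and `‖u‖_E < ∞`. -/
def MemE {N : ℕ} (lam : ℝ) (ρ u : EuclideanSpace ℝ (Fin N) → ℝ) : Prop :=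
  MemW11loc u ∧ eNormE lam ρ u < ⊤

/-- `(e m, e' m)`, `m ∈ ℕ`, is a Markushevich basis of the normed space `X`: a biorthogonal system
that is fundamental (the `e m` are linearly dense in `X`) and total (the span of the functionals
`e' m` is weak-* dense in the dual space). -/
structure IsMarkushevichBasis {X : Type*} [NormedAddCommGroup X] [NormedSpace ℝ X]
    (e : ℕ → X) (e' : ℕ → StrongDual ℝ X) : Prop where
  biorthogonal : ∀ n m : ℕ, e' m (e n) = if n = m then 1 else 0
  fundamental : closure (Submodule.span ℝ (Set.range e) : Set X) = Set.univ
  total : closure (Submodule.span ℝ (Set.range fun m => StrongDual.toWeakDual (e' m)) :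
    Set (WeakDual ℝ X)) = Set.univ

end

/-! The central point is that the Newtonian kernel is positive definite in a pointwise positive way:
$|x-y|^{2-N}=\int h_p(x)h_p(y)\,d\mu(p)$ with nonnegative Gaussians $h_p$, where $p=(t,z)$ runs over
scales and centres (`lintegral_gaussianFactor_mul`). By Tonelli the double integral becomes
$D(u)=\int\big(\int u^2h_p\,\rho\,dx\big)^2d\mu(p)$ (`coulombEnergy_eq_mixedEnergy`), so $D^{1/4}$
is the mixed norm $L^4_p(L^2(h_p\rho\,dx))$ of $u$. Minkowski's inequality, used twice, gives the
triangle inequality for it, and $\|\cdot\|_E$ is the Euclidean combination of this seminorm with the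
$L^2$ norms of $u$ and $\nabla u$.

Completeness: a Cauchy sequence and its gradients converge in $L^2$, almost everywhere along a
subsequence, and Fatou's lemma makes $D$ lower semicontinuous, which handles the Coulomb part.

Separability: a Brezis–Lieb type argument (`tendsto_mixedEnergy_zero`) shows that almost everywhere
convergence together with convergence of the energies forces $D(u_n-u)\to0$. Hence
$u\mapsto(u,\nabla u,D(u))$ into the second countable space $L^2\times L^2\times[0,\infty]$ detects
convergence along subsequences, and a countable dense subset of its range lifts to a dense subset of
$E$.

Markushevich basis: $E$ embeds continuously and injectively into $L^2$. Gram–Schmidt in $L^2$,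
applied to a linearly independent sequence with dense span, produces the $e_m$, and the functionals
are the $L^2$ inner products with them. An infinite sequence exists because a nonzero $u\in E$ stays
in $E$ when multiplied by powers of $\arctan x_j$, and these products are linearly independent. -/

/-! ### Markushevich bases by orthonormalization in a Hilbert space -/

section MarkushevichBasis

open Submodule

variable {X H : Type*} [NormedAddCommGroup X] [NormedSpace ℝ X]
  [NormedAddCommGroup H] [InnerProductSpace ℝ H]

/-- A submodule of the weak-* dual that separates points is weak-* dense. -/
theorem closure_eq_univ_of_separating (S : Submodule ℝ (WeakDual ℝ X))
    (hS : ∀ y : X, (∀ f ∈ S, f y = 0) → y = 0) : closure (S : Set (WeakDual ℝ X)) = Set.univ := by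
  by_contra hne
  obtain ⟨g, hg⟩ := (Set.ne_univ_iff_exists_notMem _).1 hne
  have : LocallyConvexSpace ℝ (WeakDual ℝ X) :=
    inferInstanceAs (LocallyConvexSpace ℝ (WeakBilin (topDualPairing ℝ X)))
  obtain ⟨F, c, hF, hc⟩ := geometric_hahn_banach_closed_point
    (s := closure (S : Set (WeakDual ℝ X))) S.convex.closure isClosed_closure hg
  have hF0 : ∀ f ∈ S, F f = 0 := by
    intro f hf
    by_contra h0
    -- A functional bounded above on a subspace vanishes there: this multiple of `f` would have the
    -- value `c + 1`.
    have := hF (((c + 1) / F f) • f) (subset_closure (S.smul_mem _ hf))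
    rw [map_smul, smul_eq_mul, div_mul_cancel₀ _ h0] at this
    linarith
  have hc0 : 0 < c := by simpa using hF 0 (subset_closure S.zero_mem)
  -- Weak-* continuous functionals are evaluations at points of `X`.
  obtain ⟨y, hy⟩ := LinearMap.dualEmbedding_surjective (topDualPairing ℝ X) F
  have hFy : ∀ f : WeakDual ℝ X, F f = f y := fun f => by rw [← hy]; rfl
  have hy0 : y = 0 := hS y fun f hf => by rw [← hFy]; exact hF0 f hf
  rw [hFy, hy0, map_zero] at hc
  linarith

/-- An infinite-dimensional separable space contains a linearly independent sequence with dense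
linear span. -/
theorem exists_linearIndependent_dense_span [TopologicalSpace.SeparableSpace X]
    (hX : ¬ FiniteDimensional ℝ X) :
    ∃ x : ℕ → X, LinearIndependent ℝ x ∧ Dense (span ℝ (Set.range x) : Set X) := by
  obtain ⟨d, hd⟩ := TopologicalSpace.exists_dense_seq X
  obtain ⟨b, hb, hspan, hli⟩ := exists_linearIndependent ℝ (Set.range d)
  have hdense : Dense (span ℝ b : Set X) := by
    rw [hspan]
    exact hd.mono subset_span
  -- A finite `b` would have a closed and dense span, which is then all of `X`.
  have hinf : b.Infinite := by
    intro hfin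
    have : FiniteDimensional ℝ (span ℝ b) := FiniteDimensional.span_of_finite ℝ hfin
    have hcl : IsClosed (span ℝ b : Set X) := (span ℝ b).closed_of_finiteDimensional
    have htop : span ℝ b = ⊤ := by
      rw [← SetLike.coe_set_eq, ← hcl.closure_eq, hdense.closure_eq]
      rfl
    rw [htop] at this
    exact hX (Module.finite_def.2 (by simpa using Module.Finite.iff_fg.1 this))
  have hcount : b.Countable := (Set.countable_range d).mono hb
  have := hcount.to_subtype
  have := hinf.to_subtype
  obtain ⟨e⟩ := nonempty_equiv_of_countable (α := ℕ) (β := b)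
  refine ⟨fun n => (e n : X), hli.comp e e.injective, ?_⟩
  have : Set.range (fun n => (e n : X)) = b := by
    rw [show (fun n => (e n : X)) = Subtype.val ∘ e from rfl,
      e.surjective.range_comp, Subtype.range_coe]
  rwa [this]

/-- A separable infinite-dimensional normed space that embeds continuously into an inner product
space has a Markushevich basis, obtained by orthonormalization in the inner product space. -/
theorem exists_isMarkushevichBasis [TopologicalSpace.SeparableSpace X]
    (hX : ¬ FiniteDimensional ℝ X) (J : X →L[ℝ] H) (hJ : Function.Injective J) :
    ∃ (e : ℕ → X) (e' : ℕ → StrongDual ℝ X), IsMarkushevichBasis e e' := by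
  obtain ⟨x, hli, hdense⟩ := exists_linearIndependent_dense_span hX
  have hliJ : LinearIndependent ℝ (J ∘ x) :=
    hli.map' (J : X →ₗ[ℝ] H) (LinearMap.ker_eq_bot.2 hJ)
  set g := InnerProductSpace.gramSchmidtNormed ℝ (J ∘ x) with hg
  have hon : Orthonormal ℝ g := InnerProductSpace.gramSchmidtNormed_orthonormal hliJ
  have hspan : span ℝ (Set.range g) = (span ℝ (Set.range x)).map (J : X →ₗ[ℝ] H) := by
    rw [hg, InnerProductSpace.span_gramSchmidtNormed_range, InnerProductSpace.span_gramSchmidt,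
      Submodule.map_span, Set.range_comp]
    rfl
  have hmem : ∀ n, ∃ y : X, J y = g n := fun n => by
    have : g n ∈ span ℝ (Set.range g) := subset_span ⟨n, rfl⟩
    rw [hspan] at this
    obtain ⟨y, -, hy⟩ := this
    exact ⟨y, hy⟩
  choose e he using hmem
  -- Gram–Schmidt preserves the span in `H`, and the injectivity of `J` pulls this back to `X`.
  have hspan_e : span ℝ (Set.range e) = span ℝ (Set.range x) := by
    refine Submodule.map_injective_of_injective (f := (J : X →ₗ[ℝ] H)) hJ ?_
    rw [← hspan, Submodule.map_span, ← Set.range_comp]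
    congr 2
    ext n
    exact he n
  refine ⟨e, fun m => (innerSL ℝ (g m)).comp J, ?_, ?_, ?_⟩
  · intro n m
    have := orthonormal_iff_ite.1 hon m n
    simp only [ContinuousLinearMap.comp_apply, innerSL_apply_apply, he, this, eq_comm]
  · rw [hspan_e]
    exact hdense.closure_eq
  · refine closure_eq_univ_of_separating _ fun y hy => ?_
    have h0 : ∀ m, inner ℝ (g m) (J y) = 0 := fun m => hy _ (subset_span ⟨m, rfl⟩)
    have h1 : ∀ z ∈ span ℝ (Set.range e), inner ℝ (J z) (J y) = 0 := by
      intro z hz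
      induction hz using Submodule.span_induction with
      | mem z hz => obtain ⟨n, rfl⟩ := hz; rw [he]; exact h0 n
      | zero => simp
      | add a b _ _ ha hb => rw [map_add, inner_add_left, ha, hb, add_zero]
      | smul c a _ ha => rw [map_smul, inner_smul_left, ha, mul_zero]
    -- Density is needed in `X` only: orthogonality extends by continuity to every `z`, in
    -- particular to `z = y`.
    have h2 : (fun z : X => inner ℝ (J z) (J y)) = fun _ => (0 : ℝ) := by
      refine Continuous.ext_on (s := (span ℝ (Set.range e) : Set X)) ?_ (by fun_prop)
        (by fun_prop) h1
      rw [hspan_e]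
      exact hdense
    have h3 : J y = 0 := inner_self_eq_zero.1 (congrFun h2 y)
    exact hJ (by rw [h3, map_zero])

end MarkushevichBasis

/-! ### Mixed-norm energies: triangle inequality, lower semicontinuity, strong convergence -/

section MixedEnergy

open Filter Topology

variable {α P : Type*} [MeasurableSpace α]

/-- The potential `p ↦ ∫ f(x) h(p, x) dσ(x)`. -/
noncomputable def potential (σ : Measure α) (h : P → α → ℝ≥0∞) (f : α → ℝ≥0∞) (p : P) : ℝ≥0∞ :=
  ∫⁻ x, f x * h p x ∂σ

variable {σ : Measure α} {h : P → α → ℝ≥0∞} {f g : α → ℝ≥0∞}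

theorem potential_congr (hfg : f =ᵐ[σ] g) : potential σ h f = potential σ h g := by
  ext p
  exact lintegral_congr_ae (hfg.mono fun x hx => by simp only [hx])

theorem potential_mono (hfg : f ≤ᵐ[σ] g) (p : P) : potential σ h f p ≤ potential σ h g p :=
  lintegral_mono_ae (hfg.mono fun x hx => by gcongr)

variable [MeasurableSpace P] {μ : Measure P}

/-- The energy `∫ (∫ f(x)² h(p, x) dσ(x))² dμ(p)`. -/
noncomputable def mixedEnergy (σ : Measure α) (μ : Measure P) (h : P → α → ℝ≥0∞)
    (f : α → ℝ≥0∞) : ℝ≥0∞ :=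
  ∫⁻ p, potential σ h (fun x => f x ^ 2) p ^ 2 ∂μ

theorem aemeasurable_potential_integrand (hh : Measurable (Function.uncurry h))
    (hf : AEMeasurable f σ) (p : P) : AEMeasurable (fun x => f x * h p x) σ :=
  hf.mul (hh.comp measurable_prodMk_left).aemeasurable

theorem measurable_potential [SFinite σ] (hh : Measurable (Function.uncurry h))
    (hf : AEMeasurable f σ) : Measurable (potential σ h f) := by
  rw [potential_congr (h := h) hf.ae_eq_mk]
  have : Measurable (Function.uncurry fun (p : P) (x : α) => hf.mk f x * h p x) :=
    (hf.measurable_mk.comp measurable_snd).mul hh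
  exact this.lintegral_prod_right'

theorem potential_add (hh : Measurable (Function.uncurry h)) (hf : AEMeasurable f σ) (p : P) :
    potential σ h (fun x => f x + g x) p = potential σ h f p + potential σ h g p := by
  simp only [potential, add_mul]
  exact lintegral_add_left' (aemeasurable_potential_integrand hh hf p) _

theorem potential_const_mul (hh : Measurable (Function.uncurry h)) (hf : AEMeasurable f σ)
    (c : ℝ≥0∞) (p : P) :
    potential σ h (fun x => c * f x) p = c * potential σ h f p := by
  simp only [potential, mul_assoc]
  exact lintegral_const_mul'' c (aemeasurable_potential_integrand hh hf p)

theorem mixedEnergy_mono (hfg : f ≤ᵐ[σ] g) :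
    mixedEnergy σ μ h f ≤ mixedEnergy σ μ h g :=
  lintegral_mono fun p => by
    have := potential_mono (h := h) (f := fun x => f x ^ 2) (g := fun x => g x ^ 2)
      (hfg.mono fun x hx => by dsimp only; gcongr) p
    gcongr

theorem mixedEnergy_const_mul (hh : Measurable (Function.uncurry h)) (hf : AEMeasurable f σ)
    {c : ℝ≥0∞} (hc : c ≠ ⊤) :
    mixedEnergy σ μ h (fun x => c * f x) = c ^ 4 * mixedEnergy σ μ h f := by
  simp only [mixedEnergy, mul_pow]
  rw [← lintegral_const_mul' _ _ (by finiteness)]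
  refine lintegral_congr fun p => ?_
  rw [potential_const_mul hh (hf.pow_const 2)]
  ring

/-- Minkowski's inequality in $L^2$ of the measure with density `h p` with respect to `σ`. -/
theorem sqrt_potential_add_le (hh : Measurable (Function.uncurry h)) (hf : AEMeasurable f σ)
    (hg : AEMeasurable g σ) (p : P) :
    potential σ h (fun x => (f x + g x) ^ 2) p ^ (1 / 2 : ℝ) ≤
      potential σ h (fun x => f x ^ 2) p ^ (1 / 2 : ℝ) +
        potential σ h (fun x => g x ^ 2) p ^ (1 / 2 : ℝ) := by
  have hhp : AEMeasurable (h p) σ := (hh.comp measurable_prodMk_left).aemeasurable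
  have key : ∀ {k : α → ℝ≥0∞}, AEMeasurable k σ → potential σ h (fun x => k x ^ 2) p =
      ∫⁻ x, k x ^ (2 : ℝ) ∂σ.withDensity (h p) := fun {k} hk => by
    rw [lintegral_withDensity_eq_lintegral_mul₀ hhp (hk.pow_const _)]
    exact lintegral_congr fun x => by simp [mul_comm]
  have hac := withDensity_absolutelyContinuous σ (h p)
  have := ENNReal.lintegral_Lp_add_le (hf.mono_ac hac) (hg.mono_ac hac) (p := 2) (by norm_num)
  rw [key hf, key hg, key (k := fun x => f x + g x) (hf.add hg)]
  exact this

/-- The fourth root of the energy is the $L^4(\mu)$ norm of the $L^2$ norms from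
`sqrt_potential_add_le`; Minkowski's inequality in $L^4$ completes the argument. -/
theorem mixedEnergy_add_le [SFinite σ] (hh : Measurable (Function.uncurry h))
    (hf : AEMeasurable f σ) (hg : AEMeasurable g σ) :
    mixedEnergy σ μ h (fun x => f x + g x) ^ (1 / 4 : ℝ) ≤
      mixedEnergy σ μ h f ^ (1 / 4 : ℝ) + mixedEnergy σ μ h g ^ (1 / 4 : ℝ) := by
  have key : ∀ k : α → ℝ≥0∞, mixedEnergy σ μ h k =
      ∫⁻ p, (potential σ h (fun x => k x ^ 2) p ^ (1 / 2 : ℝ)) ^ (4 : ℝ) ∂μ := fun k =>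
    lintegral_congr fun p => by
      rw [← ENNReal.rpow_mul, ← ENNReal.rpow_natCast]
      norm_num
  rw [key, key, key]
  refine le_trans ?_ (ENNReal.lintegral_Lp_add_le (p := 4)
    ((measurable_potential hh (hf.pow_const 2)).pow_const _).aemeasurable
    ((measurable_potential hh (hg.pow_const 2)).pow_const _).aemeasurable (by norm_num))
  gcongr with p
  exact sqrt_potential_add_le hh hf hg p

theorem potential_le_liminf {F : ℕ → α → ℝ≥0∞} (hh : Measurable (Function.uncurry h))
    (hF : ∀ n, AEMeasurable (F n) σ)
    (hlim : ∀ᵐ x ∂σ, Tendsto (fun n => F n x) atTop (𝓝 (f x)))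
    (hfin : ∀ p x, h p x ≠ ⊤) (p : P) :
    potential σ h f p ≤ liminf (fun n => potential σ h (F n) p) atTop := by
  refine le_trans (le_of_eq (lintegral_congr_ae ?_))
    (lintegral_liminf_le' fun n => aemeasurable_potential_integrand hh (hF n) p)
  filter_upwards [hlim] with x hx
  exact (ENNReal.Tendsto.mul_const hx (Or.inr (hfin p x))).liminf_eq.symm

theorem ENNReal.sq_liminf_le (a : ℕ → ℝ≥0∞) :
    liminf a atTop ^ 2 ≤ liminf (fun n => a n ^ 2) atTop := by
  have hmono : Monotone fun x : ℝ≥0∞ => x ^ 2 := fun x y hxy => by dsimp only; gcongr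
  exact (hmono.map_liminf_of_continuousAt a (ENNReal.continuous_pow 2).continuousAt).le

theorem lintegral_sq_le_liminf {A : ℕ → P → ℝ≥0∞} {B : P → ℝ≥0∞} (hA : ∀ n, Measurable (A n))
    (hB : ∀ p, B p ≤ liminf (fun n => A n p) atTop) :
    ∫⁻ p, B p ^ 2 ∂μ ≤ liminf (fun n => ∫⁻ p, A n p ^ 2 ∂μ) atTop := by
  refine le_trans (lintegral_mono fun p => ?_) (lintegral_liminf_le fun n => (hA n).pow_const 2)
  exact le_trans (by gcongr; exact hB p) (ENNReal.sq_liminf_le _)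

/-- Lower semicontinuity of the energy under a.e. convergence. -/
theorem mixedEnergy_le_liminf [SFinite σ] {F : ℕ → α → ℝ≥0∞}
    (hh : Measurable (Function.uncurry h)) (hF : ∀ n, AEMeasurable (F n) σ)
    (hlim : ∀ᵐ x ∂σ, Tendsto (fun n => F n x) atTop (𝓝 (f x)))
    (hfin : ∀ p x, h p x ≠ ⊤) :
    mixedEnergy σ μ h f ≤ liminf (fun n => mixedEnergy σ μ h (F n)) atTop :=
  lintegral_sq_le_liminf (fun n => measurable_potential hh ((hF n).pow_const 2)) fun p =>
    potential_le_liminf hh (fun n => (hF n).pow_const 2)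
      (hlim.mono fun _ hx => ENNReal.Tendsto.pow hx) hfin p

/-- If the sum is asymptotically at most `L` and `t` alone already uses up `L`, nothing is left for
`s`. Finiteness of `L` permits the subtraction. -/
theorem ENNReal.tendsto_zero_of_add_le {s t c : ℕ → ℝ≥0∞} {L : ℝ≥0∞} (hL : L ≠ ⊤)
    (hle : ∀ n, s n + t n ≤ c n) (hc : Tendsto c atTop (𝓝 L)) (ht : L ≤ liminf t atTop) :
    Tendsto s atTop (𝓝 0) := by
  -- Only a lower bound on `t` is known; truncation at `L` turns it into convergence.
  have hm : Tendsto (fun n => min (t n) L) atTop (𝓝 L) := by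
    refine tendsto_order.2 ⟨fun a ha => ?_, fun a ha => ?_⟩
    · filter_upwards [eventually_lt_of_lt_liminf (ha.trans_le ht)] with n hn
      exact lt_min hn ha
    · exact Eventually.of_forall fun n => (min_le_right _ _).trans_lt ha
  have hsub : Tendsto (fun n => c n - min (t n) L) atTop (𝓝 (L - L)) :=
    ENNReal.Tendsto.sub hc hm (Or.inl hL)
  rw [tsub_self] at hsub
  refine tendsto_of_tendsto_of_tendsto_of_le_of_le tendsto_const_nhds hsub (fun _ => zero_le)
    fun n => ?_
  refine ENNReal.le_sub_of_add_le_right (ne_top_of_le_ne_top hL (min_le_right _ _)) ?_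
  exact le_trans (by gcongr; exact min_le_left _ _) (hle n)

theorem ENNReal.add_sq_le_two_mul (a b : ℝ≥0∞) : (a + b) ^ 2 ≤ 2 * a ^ 2 + 2 * b ^ 2 := by
  have := ENNReal.rpow_add_le_mul_rpow_add_rpow a b (p := 2) (by norm_num)
  norm_num at this
  rwa [mul_add] at this

/-- If `F n → f` a.e. and the energies of `F n` converge to the finite energy of `f`, then the
energies of functions `G n ≤ F n + f` that vanish a.e. in the limit tend to zero. -/
theorem tendsto_mixedEnergy_zero [SFinite σ] {F G : ℕ → α → ℝ≥0∞}
    (hh : Measurable (Function.uncurry h)) (hfin : ∀ p x, h p x ≠ ⊤)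
    (hF : ∀ n, AEMeasurable (F n) σ) (hG : ∀ n, AEMeasurable (G n) σ) (hf : AEMeasurable f σ)
    (hle : ∀ n x, G n x ≤ F n x + f x)
    (hFlim : ∀ᵐ x ∂σ, Tendsto (fun n => F n x) atTop (𝓝 (f x)))
    (hGlim : ∀ᵐ x ∂σ, Tendsto (fun n => G n x) atTop (𝓝 0))
    (hE : mixedEnergy σ μ h f ≠ ⊤)
    (hElim : Tendsto (fun n => mixedEnergy σ μ h (F n)) atTop (𝓝 (mixedEnergy σ μ h f))) :
    Tendsto (fun n => mixedEnergy σ μ h (G n)) atTop (𝓝 0) := by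
  -- The nonnegative remainder in $G_n^2\le 2F_n^2+2f^2$. It tends to $4f^2$ almost everywhere, so
  -- Fatou's lemma bounds its energy from below by $16$ times that of $f$, the same value to which
  -- the upper bound converges.
  set R : ℕ → α → ℝ≥0∞ := fun n x => 2 * F n x ^ 2 + 2 * f x ^ 2 - G n x ^ 2 with hR
  have hRm : ∀ n, AEMeasurable (R n) σ := fun n =>
    ((((hF n).pow_const 2).const_mul 2).add ((hf.pow_const 2).const_mul 2)).sub
      ((hG n).pow_const 2)
  have hGR : ∀ n x, G n x ^ 2 + R n x = 2 * F n x ^ 2 + 2 * f x ^ 2 := by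
    intro n x
    refine add_tsub_cancel_of_le ?_
    calc G n x ^ 2 ≤ (F n x + f x) ^ 2 := by gcongr; exact hle n x
      _ ≤ 2 * F n x ^ 2 + 2 * f x ^ 2 := ENNReal.add_sq_le_two_mul _ _
  have hAB : ∀ n p, potential σ h (fun x => G n x ^ 2) p + potential σ h (R n) p =
      2 * potential σ h (fun x => F n x ^ 2) p + 2 * potential σ h (fun x => f x ^ 2) p := by
    intro n p
    rw [← potential_add hh ((hG n).pow_const 2), ← potential_const_mul hh ((hF n).pow_const 2),
      ← potential_const_mul hh (hf.pow_const 2),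
      ← potential_add hh (((hF n).pow_const 2).const_mul 2)]
    simp only [hGR]
  have hRlim : ∀ᵐ x ∂σ, Tendsto (fun n => R n x) atTop (𝓝 (4 * f x ^ 2)) := by
    filter_upwards [hFlim, hGlim] with x hx hx0
    have h1 : Tendsto (fun n => 2 * F n x ^ 2 + 2 * f x ^ 2 - G n x ^ 2) atTop
        (𝓝 (2 * f x ^ 2 + 2 * f x ^ 2 - 0 ^ 2)) := by
      refine ENNReal.Tendsto.sub ?_ (ENNReal.Tendsto.pow hx0) (Or.inr (by simp))
      exact (ENNReal.Tendsto.const_mul (ENNReal.Tendsto.pow hx) (Or.inr (by simp))).add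
        tendsto_const_nhds
    convert h1 using 2
    rw [← add_mul]
    norm_num
  have hQ : ∫⁻ p, (4 * potential σ h (fun x => f x ^ 2) p) ^ 2 ∂μ =
      16 * mixedEnergy σ μ h f := by
    simp only [mul_pow]
    rw [lintegral_const_mul' _ _ (by finiteness)]
    norm_num [mixedEnergy]
  have hmF : ∀ n, Measurable (potential σ h fun x => F n x ^ 2) := fun n =>
    measurable_potential hh ((hF n).pow_const 2)
  have hmf : Measurable (potential σ h fun x => f x ^ 2) :=
    measurable_potential hh (hf.pow_const 2)
  have hmG : ∀ n, Measurable (potential σ h fun x => G n x ^ 2) := fun n =>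
    measurable_potential hh ((hG n).pow_const 2)
  refine ENNReal.tendsto_zero_of_add_le (L := 16 * mixedEnergy σ μ h f)
    (t := fun n => ∫⁻ p, potential σ h (R n) p ^ 2 ∂μ)
    (c := fun n => (2 * mixedEnergy σ μ h (F n) ^ (1 / 2 : ℝ) +
      2 * mixedEnergy σ μ h f ^ (1 / 2 : ℝ)) ^ 2) (by finiteness) (fun n => ?_) ?_ ?_
  · calc mixedEnergy σ μ h (G n) + ∫⁻ p, potential σ h (R n) p ^ 2 ∂μ
        = ∫⁻ p, (potential σ h (fun x => G n x ^ 2) p ^ 2 + potential σ h (R n) p ^ 2) ∂μ :=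
          (lintegral_add_left ((hmG n).pow_const 2) _).symm
      _ ≤ ∫⁻ p, (2 * potential σ h (fun x => F n x ^ 2) p +
            2 * potential σ h (fun x => f x ^ 2) p) ^ 2 ∂μ := by
          refine lintegral_mono fun p => ?_
          -- The cross term in $(a+b)^2$ is nonnegative and is dropped.
          rw [← hAB, add_sq, add_right_comm]
          exact le_self_add
      _ ≤ _ := by
          have h2 := ENNReal.lintegral_Lp_add_le (μ := μ) (p := 2)
            ((hmF n).const_mul 2).aemeasurable (hmf.const_mul 2).aemeasurable (by norm_num)
          have h3 : ∀ k : α → ℝ≥0∞,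
              (∫⁻ p, (2 * potential σ h (fun x => k x ^ 2) p) ^ (2 : ℝ) ∂μ) ^ (1 / 2 : ℝ) =
              2 * mixedEnergy σ μ h k ^ (1 / 2 : ℝ) := by
            intro k
            simp only [ENNReal.mul_rpow_of_nonneg _ _ (zero_le_two (α := ℝ)), ENNReal.rpow_two]
            rw [lintegral_const_mul' _ _ (by finiteness),
              ENNReal.mul_rpow_of_nonneg _ _ (by norm_num), ← ENNReal.rpow_two,
              ← ENNReal.rpow_mul]
            norm_num [mixedEnergy]
          rw [h3, h3] at h2
          have h4 := ENNReal.rpow_le_rpow h2 (zero_le_two (α := ℝ))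
          rw [← ENNReal.rpow_mul] at h4
          norm_num at h4
          simpa using h4
  · have h1 : Tendsto (fun n => (2 * mixedEnergy σ μ h (F n) ^ (1 / 2 : ℝ) +
        2 * mixedEnergy σ μ h f ^ (1 / 2 : ℝ)) ^ 2) atTop
        (𝓝 ((2 * mixedEnergy σ μ h f ^ (1 / 2 : ℝ) +
          2 * mixedEnergy σ μ h f ^ (1 / 2 : ℝ)) ^ 2)) := by
      refine ENNReal.Tendsto.pow (Tendsto.add ?_ tendsto_const_nhds)
      exact ENNReal.Tendsto.const_mul (hElim.ennrpow_const _) (Or.inr (by simp))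
    convert h1 using 2
    rw [← add_mul, mul_pow, ← ENNReal.rpow_two (_ ^ (1 / 2 : ℝ)), ← ENNReal.rpow_mul]
    norm_num
  · rw [← hQ]
    refine lintegral_sq_le_liminf (fun n => measurable_potential hh (hRm n)) fun p => ?_
    rw [← potential_const_mul hh (hf.pow_const 2)]
    exact potential_le_liminf hh hRm hRlim hfin p

end MixedEnergy

/-! ### The Newtonian kernel as a superposition of products of Gaussians -/

section CoulombKernel

open Filter Topology

/-- Tonelli: the square of the inner integral is a double integral, and the integration over `p` is
moved inside. -/
theorem lintegral_potential_sq {α P : Type*} [MeasurableSpace α] [MeasurableSpace P]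
    {σ : Measure α} [SFinite σ] {μ : Measure P} [SFinite μ] {h : P → α → ℝ≥0∞}
    (hh : Measurable (Function.uncurry h)) {f : α → ℝ≥0∞} (hf : AEMeasurable f σ) :
    ∫⁻ p, potential σ h f p ^ 2 ∂μ =
      ∫⁻ y, ∫⁻ x, f x * f y * ∫⁻ p, h p x * h p y ∂μ ∂σ ∂σ := by
  wlog hfm : Measurable f generalizing f
  · have := this (f := hf.mk f) hf.measurable_mk.aemeasurable hf.measurable_mk
    rw [← potential_congr hf.ae_eq_mk] at this
    rw [this]
    refine lintegral_congr_ae (hf.ae_eq_mk.mono fun y hy => lintegral_congr_ae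
      (hf.ae_eq_mk.mono fun x hx => ?_))
    simp only [hx, hy]
  have hhx : ∀ x, Measurable fun p => h p x := fun x => hh.comp measurable_prodMk_right
  have h1 : ∀ p, potential σ h f p ^ 2 =
      ∫⁻ z, (f z.1 * h p z.1) * (f z.2 * h p z.2) ∂σ.prod σ := fun p => by
    rw [lintegral_prod_mul (aemeasurable_potential_integrand hh hf p)
      (aemeasurable_potential_integrand hh hf p), sq]
    rfl
  have hm1 : Measurable fun q : P × α × α => h q.1 q.2.1 :=
    hh.comp (measurable_fst.prodMk (measurable_fst.comp measurable_snd))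
  have hm2 : Measurable fun q : P × α × α => h q.1 q.2.2 :=
    hh.comp (measurable_fst.prodMk (measurable_snd.comp measurable_snd))
  have hm : Measurable (Function.uncurry fun (p : P) (z : α × α) =>
      (f z.1 * h p z.1) * (f z.2 * h p z.2)) :=
    ((hfm.comp (measurable_fst.comp measurable_snd)).mul hm1).mul
      ((hfm.comp (measurable_snd.comp measurable_snd)).mul hm2)
  have h2 : ∀ z : α × α, ∫⁻ p, (f z.1 * h p z.1) * (f z.2 * h p z.2) ∂μ =
      f z.2 * f z.1 * ∫⁻ p, h p z.2 * h p z.1 ∂μ := fun z => by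
    have hm12 : Measurable fun p => h p z.2 * h p z.1 := (hhx _).mul (hhx _)
    rw [← lintegral_const_mul _ hm12]
    exact lintegral_congr fun p => by ring
  simp only [h1]
  rw [lintegral_lintegral_swap hm.aemeasurable, lintegral_prod _ ?_]
  · exact lintegral_congr fun y => lintegral_congr fun x => h2 (y, x)
  · exact hm.lintegral_prod_left'.aemeasurable

variable {N : ℕ}

theorem lintegral_rpow_mul_exp_neg_mul {a r : ℝ} (ha : 0 < a) (hr : 0 < r) :
    ∫⁻ t in Set.Ioi (0 : ℝ), ENNReal.ofReal (t ^ (a - 1) * Real.exp (-(r * t))) =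
      ENNReal.ofReal ((1 / r) ^ a * Real.Gamma a) := by
  have h := Real.integral_rpow_mul_exp_neg_mul_Ioi ha hr
  have hpos : 0 < (1 / r) ^ a * Real.Gamma a :=
    mul_pos (Real.rpow_pos_of_pos (by positivity) _) (Real.Gamma_pos_of_pos ha)
  rw [← h, ofReal_integral_eq_lintegral_ofReal]
  · by_contra hni
    -- A non-integrable function would have Bochner integral zero, contrary to the positive value of
    -- the Gamma integral.
    rw [integral_undef hni] at h
    exact hpos.ne h
  · filter_upwards [ae_restrict_mem measurableSet_Ioi] with t ht
    have : (0 : ℝ) < t := ht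
    positivity

/-- The parallelogram law about the midpoint; it completes the square in the product of two
Gaussians centred at `x` and `y`. -/
theorem norm_sub_sq_add_norm_sub_sq (x y z : EuclideanSpace ℝ (Fin N)) :
    ‖x - z‖ ^ 2 + ‖y - z‖ ^ 2 = 2 * ‖z - (2⁻¹ : ℝ) • (x + y)‖ ^ 2 + ‖x - y‖ ^ 2 / 2 := by
  have h := parallelogram_law_with_norm ℝ (x - z) (y - z)
  have h1 : x - z + (y - z) = (-2 : ℝ) • (z - (2⁻¹ : ℝ) • (x + y)) := by module
  rw [h1, norm_smul, sub_sub_sub_cancel_right, show ‖(-2 : ℝ)‖ = 2 by norm_num] at h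
  linarith

theorem lintegral_gaussian_mul_gaussian {t : ℝ} (ht : 0 < t) (x y : EuclideanSpace ℝ (Fin N)) :
    ∫⁻ z : EuclideanSpace ℝ (Fin N), ENNReal.ofReal
        (Real.exp (-(2 * t * ‖x - z‖ ^ 2)) * Real.exp (-(2 * t * ‖y - z‖ ^ 2))) =
      ENNReal.ofReal ((Real.pi / (4 * t)) ^ ((N : ℝ) / 2) * Real.exp (-(‖x - y‖ ^ 2 * t))) := by
  have h0 : ∀ z : EuclideanSpace ℝ (Fin N), Real.exp (-(2 * t * ‖x - z‖ ^ 2)) * Real.exp (-(2 * t * ‖y - z‖ ^ 2)) =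
      Real.exp (-(‖x - y‖ ^ 2 * t)) *
        Real.exp (-(4 * t) * ‖z - (2⁻¹ : ℝ) • (x + y)‖ ^ 2) := fun z => by
    rw [← Real.exp_add, ← Real.exp_add]
    congr 1
    linear_combination (-2 * t) * norm_sub_sq_add_norm_sub_sq x y z
  have h := GaussianFourier.integral_rexp_neg_mul_sq_norm 
    (V := EuclideanSpace ℝ (Fin N)) (b := 4 * t) (by positivity)
  rw [finrank_euclideanSpace_fin] at h
  have hpos : (0 : ℝ) < (Real.pi / (4 * t)) ^ ((N : ℝ) / 2) :=
    Real.rpow_pos_of_pos (by positivity) _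
  simp only [h0, ENNReal.ofReal_mul (Real.exp_pos _).le]
  rw [lintegral_const_mul' _ _ ENNReal.ofReal_ne_top,
    lintegral_sub_right_eq_self (fun z : EuclideanSpace ℝ (Fin N) => ENNReal.ofReal (Real.exp (-(4 * t) * ‖z‖ ^ 2))),
    ← ofReal_integral_eq_lintegral_ofReal, h, mul_comm, ENNReal.ofReal_mul hpos.le]
  · by_contra hni
    rw [integral_undef hni] at h
    exact hpos.ne h
  · exact Eventually.of_forall fun z => (Real.exp_pos _).le

/-- The weight that turns the superposition of Gaussian convolutions into the Newtonian kernel. -/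
noncomputable def gaussianWeight (N : ℕ) (t : ℝ) : ℝ :=
  t ^ (((N : ℝ) - 2) / 2 - 1) / Real.Gamma (((N : ℝ) - 2) / 2) /
    (Real.pi / (4 * t)) ^ ((N : ℝ) / 2)

/-- The weighted Gaussian `x ↦ w(t)^{1/2} exp(-2t|x - z|²)`, indexed by `(t, z)`. -/
noncomputable def gaussianFactor (p : ℝ × EuclideanSpace ℝ (Fin N)) (x : EuclideanSpace ℝ (Fin N)) : ℝ≥0∞ :=
  ENNReal.ofReal (√(gaussianWeight N p.1) * Real.exp (-(2 * p.1 * ‖x - p.2‖ ^ 2)))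

/-- The parameter space of the Gaussian factors: half-line times space. -/
noncomputable def gaussianMeasure (N : ℕ) : Measure (ℝ × EuclideanSpace ℝ (Fin N)) :=
  (volume.restrict (Set.Ioi (0 : ℝ))).prod volume

instance : SFinite (gaussianMeasure N) := by unfold gaussianMeasure; infer_instance

theorem measurable_gaussianFactor :
    Measurable (Function.uncurry (gaussianFactor (N := N))) := by
  unfold gaussianFactor gaussianWeight Function.uncurry
  fun_prop

theorem gaussianFactor_ne_top (p : ℝ × EuclideanSpace ℝ (Fin N)) (x : EuclideanSpace ℝ (Fin N)) : gaussianFactor p x ≠ ⊤ :=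
  ENNReal.ofReal_ne_top

/-- Integration over the centre `z` leaves $e^{-t|x-y|^2}$ times a factor that `gaussianWeight`
cancels. What remains is the Gamma integral with exponent $a=(N-2)/2$, equal to $|x-y|^{-2a}$ after
division by $\Gamma(a)$; $N\ge3$ ensures $a>0$. -/
theorem lintegral_gaussianFactor_mul (hN : 3 ≤ N) {x y : EuclideanSpace ℝ (Fin N)} (hxy : x ≠ y) :
    ∫⁻ p, gaussianFactor p x * gaussianFactor p y ∂gaussianMeasure N =
      ENNReal.ofReal (1 / ‖x - y‖ ^ ((N : ℝ) - 2)) := by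
  have hm : ∀ x : EuclideanSpace ℝ (Fin N), Measurable fun p => gaussianFactor p x := fun x =>
    measurable_gaussianFactor.of_uncurry_right
  have hN' : (3 : ℝ) ≤ N := by exact_mod_cast hN
  have ha : 0 < ((N : ℝ) - 2) / 2 := by linarith
  have hr : 0 < ‖x - y‖ := norm_pos_iff.2 (sub_ne_zero.2 hxy)
  have hG := Real.Gamma_pos_of_pos ha
  have hmm : Measurable fun p => gaussianFactor p x * gaussianFactor p y := (hm x).mul (hm y)
  rw [gaussianMeasure, lintegral_prod _ hmm.aemeasurable]
  have h1 : ∀ t ∈ Set.Ioi (0 : ℝ),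
      ∫⁻ z : EuclideanSpace ℝ (Fin N), gaussianFactor (t, z) x * gaussianFactor (t, z) y =
      ENNReal.ofReal (Real.Gamma (((N : ℝ) - 2) / 2))⁻¹ * ENNReal.ofReal
        (t ^ (((N : ℝ) - 2) / 2 - 1) * Real.exp (-(‖x - y‖ ^ 2 * t))) := by
    intro t ht
    have ht : 0 < t := ht
    have hp : (0 : ℝ) < (Real.pi / (4 * t)) ^ ((N : ℝ) / 2) :=
      Real.rpow_pos_of_pos (by positivity) _
    have hw : 0 ≤ gaussianWeight N t := by
      have := Real.rpow_pos_of_pos ht (((N : ℝ) - 2) / 2 - 1)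
      unfold gaussianWeight
      positivity
    have h2 : ∀ z : EuclideanSpace ℝ (Fin N), gaussianFactor (t, z) x * gaussianFactor (t, z) y =
        ENNReal.ofReal (gaussianWeight N t) * ENNReal.ofReal
          (Real.exp (-(2 * t * ‖x - z‖ ^ 2)) * Real.exp (-(2 * t * ‖y - z‖ ^ 2))) := fun z => by
      rw [gaussianFactor, gaussianFactor, ← ENNReal.ofReal_mul (by positivity),
        ← ENNReal.ofReal_mul hw]
      congr 1
      linear_combination (Real.exp (-(2 * t * ‖x - z‖ ^ 2)) *
        Real.exp (-(2 * t * ‖y - z‖ ^ 2))) * Real.mul_self_sqrt hw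
    simp only [h2]
    rw [lintegral_const_mul' _ _ ENNReal.ofReal_ne_top, lintegral_gaussian_mul_gaussian ht,
      ← ENNReal.ofReal_mul hw, ← ENNReal.ofReal_mul (by positivity)]
    congr 1
    unfold gaussianWeight
    field_simp
  rw [setLIntegral_congr_fun measurableSet_Ioi h1, lintegral_const_mul' _ _ ENNReal.ofReal_ne_top,
    lintegral_rpow_mul_exp_neg_mul ha (by positivity), ← ENNReal.ofReal_mul (by positivity)]
  congr 1
  rw [one_div, Real.inv_rpow (by positivity), ← Real.rpow_natCast, ← Real.rpow_mul hr.le]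
  field_simp
  congr 1
  push_cast
  ring

theorem Real.enorm_sq (r : ℝ) : ‖r‖ₑ ^ 2 = ENNReal.ofReal (r ^ 2) := by
  rw [← ofReal_norm, ← ENNReal.ofReal_pow (norm_nonneg _), Real.norm_eq_abs, sq_abs]

/-- The Coulomb energy is the energy of a superposition of squares of Gaussian potentials. -/
theorem coulombEnergy_eq_mixedEnergy (hN : 3 ≤ N) {ρ u : EuclideanSpace ℝ (Fin N) → ℝ} (hρ : AEMeasurable ρ volume)
    (hρ0 : ∀ᵐ x, 0 ≤ ρ x) (hu : AEMeasurable u volume) :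
    coulombEnergy ρ u = mixedEnergy (volume.withDensity fun x => ENNReal.ofReal (ρ x))
      (gaussianMeasure N) gaussianFactor fun x => ‖u x‖ₑ := by
  have : Nonempty (Fin N) := ⟨⟨0, by omega⟩⟩
  have hu2 : AEMeasurable (fun x => ‖u x‖ₑ ^ 2) volume := hu.enorm.pow_const 2
  have hpot : potential (volume.withDensity fun x => ENNReal.ofReal (ρ x))
      (gaussianFactor (N := N)) (fun x => ‖u x‖ₑ ^ 2) =
      potential volume gaussianFactor fun x => ENNReal.ofReal (ρ x) * ‖u x‖ₑ ^ 2 := by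
    ext p
    unfold potential
    rw [lintegral_withDensity_eq_lintegral_mul₀ hρ.ennreal_ofReal
      (aemeasurable_potential_integrand measurable_gaussianFactor hu2 p)]
    exact lintegral_congr fun x => by simp [mul_assoc]
  have hρu : AEMeasurable (fun x => ENNReal.ofReal (ρ x) * ‖u x‖ₑ ^ 2) volume :=
    hρ.ennreal_ofReal.mul hu2
  rw [mixedEnergy, hpot, lintegral_potential_sq measurable_gaussianFactor hρu]
  refine lintegral_congr_ae (hρ0.mono fun y hy => lintegral_congr_ae ?_)
  -- The kernel identity holds off the diagonal, which for fixed `y` is a single null point.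
  filter_upwards [hρ0, compl_mem_ae_iff.2 (measure_singleton y)] with x hx hxy
  rw [lintegral_gaussianFactor_mul hN hxy]
  simp only [Real.enorm_sq]
  rw [← ENNReal.ofReal_mul hx, ← ENNReal.ofReal_mul hy, ← ENNReal.ofReal_mul (by positivity),
    ← ENNReal.ofReal_mul (by positivity)]
  congr 1
  ring

end CoulombKernel

/-! ### Calculus of weak gradients -/

section WeakGradient

open Filter Topology

variable {N : ℕ} {u v : EuclideanSpace ℝ (Fin N) → ℝ}
  {G H : EuclideanSpace ℝ (Fin N) → EuclideanSpace ℝ (Fin N)}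

theorem MeasureTheory.LocallyIntegrable.euclidean_apply (hG : LocallyIntegrable G) (i : Fin N) :
    LocallyIntegrable fun x => G x i :=
  hG.mono ((EuclideanSpace.proj (𝕜 := ℝ) i).continuous.comp_aestronglyMeasurable
    hG.aestronglyMeasurable) (Eventually.of_forall fun x => PiLp.norm_apply_le (G x) i)

theorem ContDiff.continuous_partial {φ : EuclideanSpace ℝ (Fin N) → ℝ} (hφ : ContDiff ℝ ∞ φ)
    (i : Fin N) : Continuous fun x => fderiv ℝ φ x (EuclideanSpace.single i 1) :=
  (hφ.continuous_fderiv (by simp)).clm_apply continuous_const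

theorem HasCompactSupport.partial {φ : EuclideanSpace ℝ (Fin N) → ℝ} (hφc : HasCompactSupport φ)
    (i : Fin N) : HasCompactSupport fun x => fderiv ℝ φ x (EuclideanSpace.single i 1) :=
  hφc.fderiv_apply (𝕜 := ℝ) _

theorem MeasureTheory.LocallyIntegrable.integrable_mul_partial (hu : LocallyIntegrable u)
    {φ : EuclideanSpace ℝ (Fin N) → ℝ} (hφ : ContDiff ℝ ∞ φ) (i : Fin N)
    (hφc : HasCompactSupport φ) :
    Integrable fun x => u x * fderiv ℝ φ x (EuclideanSpace.single i 1) :=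
  hu.integrable_smul_right_of_hasCompactSupport (hφ.continuous_partial i) (hφc.partial i)

theorem MeasureTheory.LocallyIntegrable.integrable_mul_test (hu : LocallyIntegrable u)
    {φ : EuclideanSpace ℝ (Fin N) → ℝ} (hφ : ContDiff ℝ ∞ φ) (hφc : HasCompactSupport φ) :
    Integrable fun x => u x * φ x :=
  hu.integrable_smul_right_of_hasCompactSupport hφ.continuous hφc

theorem HasWeakGradient.congr (h : HasWeakGradient u G) (huv : u =ᵐ[volume] v)
    (hGH : G =ᵐ[volume] H) : HasWeakGradient v H := by
  intro φ hφ hφc i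
  have h1 : ∫ x, v x * fderiv ℝ φ x (EuclideanSpace.single i 1) =
      ∫ x, u x * fderiv ℝ φ x (EuclideanSpace.single i 1) :=
    integral_congr_ae (huv.mono fun x hx => by simp only [hx])
  have h2 : ∫ x, H x i * φ x = ∫ x, G x i * φ x :=
    integral_congr_ae (hGH.mono fun x hx => by simp only [hx])
  rw [h1, h2, h φ hφ hφc i]

/-- Locally integrable functions are determined by their integrals against test functions. This
makes the chosen `weakGradient` linear up to null sets. -/
theorem HasWeakGradient.ae_eq (hG : LocallyIntegrable G) (hH : LocallyIntegrable H)
    (h : HasWeakGradient u G) (h' : HasWeakGradient u H) : G =ᵐ[volume] H := by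
  have key : ∀ i : Fin N, ∀ᵐ x, G x i = H x i := fun i =>
    ae_eq_of_integral_contDiff_smul_eq (hG.euclidean_apply i) (hH.euclidean_apply i)
      fun φ hφ hφc => by
        have := (h φ hφ hφc i).symm.trans (h' φ hφ hφc i)
        simpa [mul_comm] using this
  filter_upwards [ae_all_iff.2 key] with x hx
  ext i
  exact hx i

theorem HasWeakGradient.add (hu : LocallyIntegrable u) (hv : LocallyIntegrable v)
    (hG : LocallyIntegrable G) (hH : LocallyIntegrable H)
    (h : HasWeakGradient u G) (h' : HasWeakGradient v H) :
    HasWeakGradient (u + v) (G + H) := by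
  intro φ hφ hφc i
  simp only [Pi.add_apply, PiLp.add_apply, add_mul]
  rw [integral_add (hu.integrable_mul_partial hφ i hφc) (hv.integrable_mul_partial hφ i hφc),
    integral_add ((hG.euclidean_apply i).integrable_mul_test hφ hφc)
      ((hH.euclidean_apply i).integrable_mul_test hφ hφc), h φ hφ hφc i, h' φ hφ hφc i]
  ring

theorem HasWeakGradient.const_smul (h : HasWeakGradient u G) (c : ℝ) :
    HasWeakGradient (c • u) (c • G) := by
  intro φ hφ hφc i
  simp only [Pi.smul_apply, PiLp.smul_apply, smul_eq_mul, mul_assoc]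
  rw [integral_const_mul, integral_const_mul, h φ hφ hφc i]
  ring

theorem MemW11loc.weakGradient_spec (h : MemW11loc u) :
    LocallyIntegrable (weakGradient u) ∧ HasWeakGradient u (weakGradient u) := by
  rw [weakGradient, dif_pos h]
  exact h.2.choose_spec

theorem weakGradient_ae_eq (hu : LocallyIntegrable u) (hG : LocallyIntegrable G)
    (h : HasWeakGradient u G) : weakGradient u =ᵐ[volume] G := by
  have hW : MemW11loc u := ⟨hu, G, hG, h⟩
  exact HasWeakGradient.ae_eq hW.weakGradient_spec.1 hG hW.weakGradient_spec.2 h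

theorem MemW11loc.congr (h : MemW11loc u) (huv : u =ᵐ[volume] v) : MemW11loc v :=
  ⟨h.1.congr huv, _, h.weakGradient_spec.1, h.weakGradient_spec.2.congr huv .rfl⟩

theorem MemW11loc.weakGradient_congr (h : MemW11loc u) (huv : u =ᵐ[volume] v) :
    weakGradient v =ᵐ[volume] weakGradient u :=
  weakGradient_ae_eq (h.1.congr huv) h.weakGradient_spec.1 (h.weakGradient_spec.2.congr huv .rfl)

theorem MemW11loc.add (h : MemW11loc u) (h' : MemW11loc v) : MemW11loc (u + v) :=
  ⟨h.1.add h'.1, _, h.weakGradient_spec.1.add h'.weakGradient_spec.1,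
    h.weakGradient_spec.2.add h.1 h'.1 h.weakGradient_spec.1 h'.weakGradient_spec.1
      h'.weakGradient_spec.2⟩

theorem MemW11loc.weakGradient_add (h : MemW11loc u) (h' : MemW11loc v) :
    weakGradient (u + v) =ᵐ[volume] weakGradient u + weakGradient v :=
  weakGradient_ae_eq (h.1.add h'.1) (h.weakGradient_spec.1.add h'.weakGradient_spec.1)
    (h.weakGradient_spec.2.add h.1 h'.1 h.weakGradient_spec.1 h'.weakGradient_spec.1
      h'.weakGradient_spec.2)

theorem MemW11loc.const_smul (h : MemW11loc u) (c : ℝ) : MemW11loc (c • u) :=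
  ⟨h.1.smul c, _, h.weakGradient_spec.1.smul c, h.weakGradient_spec.2.const_smul c⟩

theorem MemW11loc.weakGradient_const_smul (h : MemW11loc u) (c : ℝ) :
    weakGradient (c • u) =ᵐ[volume] c • weakGradient u :=
  weakGradient_ae_eq (h.1.smul c) (h.weakGradient_spec.1.smul c)
    (h.weakGradient_spec.2.const_smul c)

/-- The product rule for a weakly differentiable function and a smooth function. -/
theorem HasWeakGradient.smooth_mul (hu : LocallyIntegrable u) (hG : LocallyIntegrable G)
    (h : HasWeakGradient u G) {η : EuclideanSpace ℝ (Fin N) → ℝ} (hη : ContDiff ℝ ∞ η)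
    (hH : ∀ x i, H x i = η x * G x i + u x * fderiv ℝ η x (EuclideanSpace.single i 1)) :
    HasWeakGradient (fun x => η x * u x) H := by
  intro φ hφ hφc i
  have hηφ : ContDiff ℝ ∞ (fun x => η x * φ x) := hη.mul hφ
  have hηφc : HasCompactSupport (fun x => η x * φ x) := hφc.mul_left
  have hd : ∀ x, fderiv ℝ (fun x => η x * φ x) x (EuclideanSpace.single i 1) =
      η x * fderiv ℝ φ x (EuclideanSpace.single i 1) +
        φ x * fderiv ℝ η x (EuclideanSpace.single i 1) := fun x => by
    rw [fderiv_fun_mul (hη.differentiable (by simp) x) (hφ.differentiable (by simp) x)]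
    simp
  -- The product `η φ` is itself a test function for `u`.
  have key := h _ hηφ hηφc i
  have hint1 : Integrable fun x =>
      u x * (φ x * fderiv ℝ η x (EuclideanSpace.single i 1)) :=
    hu.integrable_smul_right_of_hasCompactSupport (hφ.continuous.mul (hη.continuous_partial i))
      hφc.mul_right
  have hint2 : Integrable fun x =>
      u x * fderiv ℝ (fun x => η x * φ x) x (EuclideanSpace.single i 1) :=
    hu.integrable_mul_partial hηφ i hηφc
  have hint3 : Integrable fun x => G x i * (η x * φ x) :=
    (hG.euclidean_apply i).integrable_mul_test hηφ hηφc
  calc ∫ x, η x * u x * fderiv ℝ φ x (EuclideanSpace.single i 1)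
      = ∫ x, (u x * fderiv ℝ (fun x => η x * φ x) x (EuclideanSpace.single i 1) -
          u x * (φ x * fderiv ℝ η x (EuclideanSpace.single i 1))) := by
        refine integral_congr_ae (Eventually.of_forall fun x => ?_)
        simp only [hd]
        ring
    _ = -(∫ x, G x i * (η x * φ x)) -
          ∫ x, u x * (φ x * fderiv ℝ η x (EuclideanSpace.single i 1)) := by
        rw [integral_sub hint2 hint1, key]
    _ = -∫ x, H x i * φ x := by
        rw [← neg_add', ← integral_add hint3 hint1]
        congr 1
        refine integral_congr_ae (Eventually.of_forall fun x => ?_)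
        simp only [hH]
        ring

/-- Weak gradients pass to limits in `L²`. -/
theorem HasWeakGradient.of_tendsto
    {U : ℕ → Lp ℝ 2 (volume : Measure (EuclideanSpace ℝ (Fin N)))}
    {W : ℕ → Lp (EuclideanSpace ℝ (Fin N)) 2 (volume : Measure (EuclideanSpace ℝ (Fin N)))}
    {U' : Lp ℝ 2 (volume : Measure (EuclideanSpace ℝ (Fin N)))}
    {W' : Lp (EuclideanSpace ℝ (Fin N)) 2 (volume : Measure (EuclideanSpace ℝ (Fin N)))}
    (hU : Tendsto U atTop (𝓝 U')) (hW : Tendsto W atTop (𝓝 W'))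
    (h : ∀ n, HasWeakGradient (U n) (W n)) : HasWeakGradient U' W' := by
  intro φ hφ hφc i
  -- Both sides of the weak identity become $L^2$ inner products with fixed elements, hence are
  -- continuous in the function and in the gradient.
  have hψ : MemLp (fun x => fderiv ℝ φ x (EuclideanSpace.single i 1)) 2
      (volume : Measure (EuclideanSpace ℝ (Fin N))) :=
    (hφ.continuous_partial i).memLp_of_hasCompactSupport (hφc.partial i)
  have hχ : MemLp (fun x => φ x • EuclideanSpace.single i (1 : ℝ)) 2
      (volume : Measure (EuclideanSpace ℝ (Fin N))) :=
    (hφ.continuous.smul continuous_const).memLp_of_hasCompactSupport hφc.smul_right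
  have h1 : ∀ F : Lp ℝ 2 (volume : Measure (EuclideanSpace ℝ (Fin N))),
      inner ℝ hψ.toLp F = ∫ x, F x * fderiv ℝ φ x (EuclideanSpace.single i 1) := fun F => by
    rw [L2.inner_def]
    refine integral_congr_ae (hψ.coeFn_toLp.mono fun x hx => ?_)
    simp only [hx]
    simp
  have h2 : ∀ F : Lp (EuclideanSpace ℝ (Fin N)) 2 (volume : Measure (EuclideanSpace ℝ (Fin N))),
      inner ℝ hχ.toLp F = ∫ x, F x i * φ x := fun F => by
    rw [L2.inner_def]
    refine integral_congr_ae (hχ.coeFn_toLp.mono fun x hx => ?_)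
    simp only [hx]
    simp [inner_smul_left, EuclideanSpace.inner_single_left, mul_comm]
  have t1 : Tendsto (fun n => inner ℝ hψ.toLp (U n)) atTop (𝓝 (inner ℝ hψ.toLp U')) :=
    tendsto_const_nhds.inner hU
  have t2 : Tendsto (fun n => -inner ℝ hχ.toLp (W n)) atTop (𝓝 (-inner ℝ hχ.toLp W')) :=
    (tendsto_const_nhds.inner hW).neg
  have := tendsto_nhds_unique (t1.congr fun n => by rw [h1, h2, h n φ hφ hφc i]) t2
  rwa [h1, h2] at this

end WeakGradient

/-! ### The energy norm and the linear space it defines -/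

section EnergyNorm

open Filter Topology

variable {N : ℕ} {lam : ℝ} {ρ u v : EuclideanSpace ℝ (Fin N) → ℝ}

theorem lintegral_enorm_sq {α F : Type*} [MeasurableSpace α] {μ : Measure α}
    [NormedAddCommGroup F] (f : α → F) : ∫⁻ x, ‖f x‖ₑ ^ 2 ∂μ = eLpNorm f 2 μ ^ 2 := by
  have := eLpNorm_nnreal_pow_eq_lintegral (f := f) (μ := μ) (p := 2) (by norm_num)
  norm_num at this
  exact this.symm

theorem sobolevEnergy_eq (hu : AEMeasurable u volume) :
    sobolevEnergy u = eLpNorm (weakGradient u) 2 ^ 2 + eLpNorm u 2 ^ 2 := by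
  rw [← lintegral_enorm_sq, ← lintegral_enorm_sq, ← lintegral_add_right' _ (hu.enorm.pow_const 2)]
  refine lintegral_congr fun x => ?_
  rw [ENNReal.ofReal_add (by positivity) (by positivity), Real.enorm_sq,
    ENNReal.ofReal_pow (norm_nonneg _), ofReal_norm]

/-- The seminorm `λ^{1/2} D(u², u²)^{1/4}` given by the Coulomb energy. -/
noncomputable def coulombSeminorm (lam : ℝ) (ρ u : EuclideanSpace ℝ (Fin N) → ℝ) : ℝ≥0∞ :=
  ENNReal.ofReal lam ^ (1 / 2 : ℝ) * coulombEnergy ρ u ^ (1 / 4 : ℝ)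

/-- This form exhibits the norm as the Euclidean length of a vector of three seminorms, so its
triangle inequality reduces to theirs and to Minkowski's inequality for three terms. -/
theorem eNormE_eq (hu : AEMeasurable u volume) :
    eNormE lam ρ u = (eLpNorm (weakGradient u) 2 ^ 2 + eLpNorm u 2 ^ 2 +
      coulombSeminorm lam ρ u ^ 2) ^ (1 / 2 : ℝ) := by
  rw [eNormE, sobolevEnergy_eq hu, coulombSeminorm, mul_pow, ← ENNReal.rpow_two (_ ^ (1 / 2 : ℝ)),
    ← ENNReal.rpow_two (_ ^ (1 / 4 : ℝ)), ← ENNReal.rpow_mul, ← ENNReal.rpow_mul]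
  norm_num

theorem ENNReal.sqrt_sq_add_sq_add_sq_add_le (a b c a' b' c' : ℝ≥0∞) :
    ((a + a') ^ 2 + (b + b') ^ 2 + (c + c') ^ 2) ^ (1 / 2 : ℝ) ≤
      (a ^ 2 + b ^ 2 + c ^ 2) ^ (1 / 2 : ℝ) + (a' ^ 2 + b' ^ 2 + c' ^ 2) ^ (1 / 2 : ℝ) := by
  have := ENNReal.Lp_add_le Finset.univ ![a, b, c] ![a', b', c'] (p := 2) (by norm_num)
  simpa [Fin.sum_univ_three] using this

theorem ENNReal.le_sqrt_of_sq_le {a b : ℝ≥0∞} (h : a ^ 2 ≤ b) : a ≤ b ^ (1 / 2 : ℝ) := by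
  have := ENNReal.rpow_le_rpow h (by norm_num : (0 : ℝ) ≤ 1 / 2)
  rw [← ENNReal.rpow_two, ← ENNReal.rpow_mul] at this
  norm_num at this ⊢
  exact this

theorem ENNReal.sqrt_le_of_le_sq {a b : ℝ≥0∞} (h : b ≤ a ^ 2) : b ^ (1 / 2 : ℝ) ≤ a := by
  have := ENNReal.rpow_le_rpow h (by norm_num : (0 : ℝ) ≤ 1 / 2)
  rw [← ENNReal.rpow_two, ← ENNReal.rpow_mul] at this
  norm_num at this ⊢
  exact this

theorem eLpNorm_weakGradient_le_eNormE (hu : AEMeasurable u volume) :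
    eLpNorm (weakGradient u) 2 ≤ eNormE lam ρ u := by
  rw [eNormE_eq hu]
  exact ENNReal.le_sqrt_of_sq_le (le_trans le_self_add le_self_add)

theorem eLpNorm_le_eNormE (hu : AEMeasurable u volume) : eLpNorm u 2 ≤ eNormE lam ρ u := by
  rw [eNormE_eq hu]
  exact ENNReal.le_sqrt_of_sq_le (le_trans le_add_self le_self_add)

theorem coulombSeminorm_le_eNormE (hu : AEMeasurable u volume) :
    coulombSeminorm lam ρ u ≤ eNormE lam ρ u := by
  rw [eNormE_eq hu]
  exact ENNReal.le_sqrt_of_sq_le le_add_self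

theorem eNormE_le_add (hu : AEMeasurable u volume) :
    eNormE lam ρ u ≤ eLpNorm (weakGradient u) 2 + eLpNorm u 2 + coulombSeminorm lam ρ u := by
  rw [eNormE_eq hu]
  have hsq : ∀ a b : ℝ≥0∞, a ^ 2 + b ^ 2 ≤ (a + b) ^ 2 := fun a b => by
    rw [add_sq]
    gcongr
    exact le_self_add
  exact ENNReal.sqrt_le_of_le_sq (le_trans (by gcongr; exact hsq _ _) (hsq _ _))

theorem coulombEnergy_congr (huv : u =ᵐ[volume] v) : coulombEnergy ρ u = coulombEnergy ρ v :=
  lintegral_congr_ae (huv.mono fun y hy => lintegral_congr_ae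
    (huv.mono fun x hx => by simp only [hx, hy]))

theorem eNormE_congr (hu : MemW11loc u) (huv : u =ᵐ[volume] v) :
    eNormE lam ρ v = eNormE lam ρ u := by
  have hum := hu.1.aestronglyMeasurable.aemeasurable
  rw [eNormE_eq hum, eNormE_eq (hum.congr huv), eLpNorm_congr_ae huv,
    eLpNorm_congr_ae (hu.weakGradient_congr huv), coulombSeminorm, coulombSeminorm,
    coulombEnergy_congr huv]

theorem MemE.congr (hu : MemE lam ρ u) (huv : u =ᵐ[volume] v) : MemE lam ρ v :=
  ⟨hu.1.congr huv, by rw [eNormE_congr hu.1 huv]; exact hu.2⟩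

theorem MemE.aemeasurable (hu : MemE lam ρ u) : AEMeasurable u volume :=
  hu.1.1.aestronglyMeasurable.aemeasurable

theorem MemE.memLp (hu : MemE lam ρ u) : MemLp u 2 :=
  ⟨hu.1.1.aestronglyMeasurable, (eLpNorm_le_eNormE hu.aemeasurable).trans_lt hu.2⟩

theorem MemE.memLp_weakGradient (hu : MemE lam ρ u) : MemLp (weakGradient u) 2 :=
  ⟨hu.1.weakGradient_spec.1.aestronglyMeasurable,
    (eLpNorm_weakGradient_le_eNormE hu.aemeasurable).trans_lt hu.2⟩

theorem coulombSeminorm_ne_top_iff (hlam : 0 < lam) :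
    coulombSeminorm lam ρ u ≠ ⊤ ↔ coulombEnergy ρ u ≠ ⊤ := by
  rw [coulombSeminorm, Ne, Ne, ENNReal.mul_eq_top]
  simp [ENNReal.rpow_eq_top_iff, hlam]

theorem MemE.coulombEnergy_ne_top (hlam : 0 < lam) (hu : MemE lam ρ u) :
    coulombEnergy ρ u ≠ ⊤ :=
  (coulombSeminorm_ne_top_iff hlam).1
    ((coulombSeminorm_le_eNormE hu.aemeasurable).trans_lt hu.2).ne

theorem MemE.of_finite (hlam : 0 < lam) (hW : MemW11loc u) (hu : MemLp u 2)
    (hG : MemLp (weakGradient u) 2) (hC : coulombEnergy ρ u ≠ ⊤) : MemE lam ρ u :=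
  ⟨hW, (eNormE_le_add hu.1.aemeasurable).trans_lt (ENNReal.add_lt_top.2
    ⟨ENNReal.add_lt_top.2 ⟨hG.2, hu.2⟩, ((coulombSeminorm_ne_top_iff hlam).2 hC).lt_top⟩)⟩

theorem eNormE_const_smul (hN : 3 ≤ N) (hρ : AEMeasurable ρ volume) (hρ0 : ∀ᵐ x, 0 ≤ ρ x)
    (hu : MemW11loc u) (c : ℝ) : eNormE lam ρ (c • u) = ‖c‖ₑ * eNormE lam ρ u := by
  have hum := hu.1.aestronglyMeasurable.aemeasurable
  have hC : coulombSeminorm lam ρ (c • u) = ‖c‖ₑ * coulombSeminorm lam ρ u := by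
    rw [coulombSeminorm, coulombSeminorm, coulombEnergy_eq_mixedEnergy hN hρ hρ0 hum,
      coulombEnergy_eq_mixedEnergy hN hρ hρ0 (hum.const_smul c)]
    simp only [Pi.smul_apply, enorm_smul]
    rw [mixedEnergy_const_mul measurable_gaussianFactor
      (hum.enorm.mono_ac (withDensity_absolutelyContinuous _ _)) enorm_ne_top,
      ENNReal.mul_rpow_of_nonneg _ _ (by norm_num), ← ENNReal.rpow_natCast, ← ENNReal.rpow_mul]
    norm_num
    ring
  rw [eNormE_eq hum, eNormE_eq (hum.const_smul c), eLpNorm_congr_ae (hu.weakGradient_const_smul c),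
    eLpNorm_const_smul, eLpNorm_const_smul, hC, mul_pow, mul_pow, mul_pow, ← mul_add, ← mul_add,
    ENNReal.mul_rpow_of_nonneg _ _ (by norm_num), ← ENNReal.rpow_two ‖c‖ₑ, ← ENNReal.rpow_mul]
  norm_num

theorem coulombSeminorm_add_le (hN : 3 ≤ N) (hρ : AEMeasurable ρ volume) (hρ0 : ∀ᵐ x, 0 ≤ ρ x)
    (hu : AEMeasurable u volume) (hv : AEMeasurable v volume) :
    coulombSeminorm lam ρ (u + v) ≤ coulombSeminorm lam ρ u + coulombSeminorm lam ρ v := by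
  rw [coulombSeminorm, coulombSeminorm, coulombSeminorm, ← mul_add,
    coulombEnergy_eq_mixedEnergy hN hρ hρ0 hu, coulombEnergy_eq_mixedEnergy hN hρ hρ0 hv,
    coulombEnergy_eq_mixedEnergy hN hρ hρ0 (hu.add hv)]
  gcongr
  refine le_trans ?_ (mixedEnergy_add_le measurable_gaussianFactor
    (hu.enorm.mono_ac (withDensity_absolutelyContinuous _ _))
    (hv.enorm.mono_ac (withDensity_absolutelyContinuous _ _)))
  gcongr
  exact mixedEnergy_mono (Eventually.of_forall fun x => enorm_add_le _ _)

theorem eNormE_add_le (hN : 3 ≤ N) (hρ : AEMeasurable ρ volume) (hρ0 : ∀ᵐ x, 0 ≤ ρ x)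
    (hu : MemW11loc u) (hv : MemW11loc v) :
    eNormE lam ρ (u + v) ≤ eNormE lam ρ u + eNormE lam ρ v := by
  have hum := hu.1.aestronglyMeasurable
  have hvm := hv.1.aestronglyMeasurable
  rw [eNormE_eq hum.aemeasurable, eNormE_eq hvm.aemeasurable,
    eNormE_eq (hum.aemeasurable.add hvm.aemeasurable), eLpNorm_congr_ae (hu.weakGradient_add hv)]
  refine le_trans ?_ (ENNReal.sqrt_sq_add_sq_add_sq_add_le _ _ _ _ _ _)
  gcongr
  · exact eLpNorm_add_le hu.weakGradient_spec.1.aestronglyMeasurable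
      hv.weakGradient_spec.1.aestronglyMeasurable (by norm_num)
  · exact eLpNorm_add_le hum hvm (by norm_num)
  · exact coulombSeminorm_add_le hN hρ hρ0 hum.aemeasurable hvm.aemeasurable

theorem MemE.zero : MemE lam ρ (0 : EuclideanSpace ℝ (Fin N) → ℝ) := by
  have hW : HasWeakGradient (0 : EuclideanSpace ℝ (Fin N) → ℝ) 0 := fun φ _ _ i => by simp
  have h0 : weakGradient (0 : EuclideanSpace ℝ (Fin N) → ℝ) =ᵐ[volume] 0 :=
    weakGradient_ae_eq locallyIntegrable_zero locallyIntegrable_zero hW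
  refine ⟨⟨locallyIntegrable_zero, 0, locallyIntegrable_zero, hW⟩, ?_⟩
  rw [eNormE_eq (u := 0) aemeasurable_const, eLpNorm_congr_ae h0]
  simp [coulombSeminorm, coulombEnergy]

theorem MemE.add (hN : 3 ≤ N) (hρ : AEMeasurable ρ volume) (hρ0 : ∀ᵐ x, 0 ≤ ρ x)
    (hu : MemE lam ρ u) (hv : MemE lam ρ v) : MemE lam ρ (u + v) :=
  ⟨hu.1.add hv.1, (eNormE_add_le hN hρ hρ0 hu.1 hv.1).trans_lt (ENNReal.add_lt_top.2 ⟨hu.2, hv.2⟩)⟩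

theorem MemE.const_smul (hN : 3 ≤ N) (hρ : AEMeasurable ρ volume) (hρ0 : ∀ᵐ x, 0 ≤ ρ x)
    (hu : MemE lam ρ u) (c : ℝ) : MemE lam ρ (c • u) :=
  ⟨hu.1.const_smul c, by
    rw [eNormE_const_smul hN hρ hρ0 hu.1]; exact ENNReal.mul_lt_top enorm_lt_top hu.2⟩

/-- The space `E(ℝ^N)` as a linear subspace of the measurable functions modulo a.e. equality. -/
noncomputable def energySpace (lam : ℝ) (hN : 3 ≤ N) (hρ : AEMeasurable ρ volume)
    (hρ0 : ∀ᵐ x, 0 ≤ ρ x) : Submodule ℝ (EuclideanSpace ℝ (Fin N) →ₘ[volume] ℝ) where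
  carrier := {u | MemE lam ρ u}
  zero_mem' := MemE.zero.congr (AEEqFun.coeFn_zero (α := EuclideanSpace ℝ (Fin N))).symm
  add_mem' := fun {u v} hu hv => (MemE.add hN hρ hρ0 hu hv).congr (AEEqFun.coeFn_add u v).symm
  smul_mem' := fun c u hu =>
    (MemE.const_smul hN hρ hρ0 hu c).congr (AEEqFun.coeFn_smul c u).symm

theorem energySpace_core (hN : 3 ≤ N) (hρ : AEMeasurable ρ volume) (hρ0 : ∀ᵐ x, 0 ≤ ρ x) :
    letI : Norm (energySpace lam hN hρ hρ0) :=
      ⟨fun u => (eNormE lam ρ (u : EuclideanSpace ℝ (Fin N) →ₘ[volume] ℝ)).toReal⟩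
    NormedSpace.Core ℝ (energySpace lam hN hρ hρ0) := by
  let : Norm (energySpace lam hN hρ hρ0) :=
    ⟨fun u => (eNormE lam ρ (u : EuclideanSpace ℝ (Fin N) →ₘ[volume] ℝ)).toReal⟩
  have hnorm : ∀ u : energySpace lam hN hρ hρ0, ‖u‖ =
    (eNormE lam ρ (u : EuclideanSpace ℝ (Fin N) →ₘ[volume] ℝ)).toReal := fun _ => rfl
  have hsmul : ∀ (c : ℝ) (u : energySpace lam hN hρ hρ0), ‖c • u‖ = ‖c‖ * ‖u‖ := fun c u => by
    rw [hnorm, hnorm, Submodule.coe_smul,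
      eNormE_congr (u.2.1.const_smul c) (AEEqFun.coeFn_smul c u.1).symm,
      eNormE_const_smul hN hρ hρ0 u.2.1, ENNReal.toReal_mul, toReal_enorm]
  refine { norm_nonneg := fun u => ENNReal.toReal_nonneg, norm_smul := hsmul,
           norm_triangle := fun u v => ?_, norm_eq_zero_iff := fun u => ⟨fun h => ?_, ?_⟩ }
  · rw [hnorm, hnorm, hnorm, Submodule.coe_add,
      eNormE_congr (u.2.1.add v.2.1) (AEEqFun.coeFn_add u.1 v.1).symm,
      ← ENNReal.toReal_add u.2.2.ne v.2.2.ne]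
    exact ENNReal.toReal_mono (ENNReal.add_lt_top.2 ⟨u.2.2, v.2.2⟩).ne
      (eNormE_add_le hN hρ hρ0 u.2.1 v.2.1)
  · have h0 : eNormE lam ρ u.1 = 0 := by
      rw [hnorm, ENNReal.toReal_eq_zero_iff] at h
      exact h.resolve_right u.2.2.ne
    -- Definiteness comes from the $L^2$ part alone.
    have h1 : eLpNorm u.1 2 volume = 0 := le_antisymm
      (h0 ▸ eLpNorm_le_eNormE (lam := lam) (ρ := ρ) u.1.aemeasurable) zero_le
    rw [eLpNorm_eq_zero_iff u.1.aestronglyMeasurable (by norm_num)] at h1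
    exact Subtype.ext (AEEqFun.ext (h1.trans AEEqFun.coeFn_zero.symm))
  · rintro rfl
    have := hsmul 0 0
    rwa [zero_smul, norm_zero, zero_mul] at this

end EnergyNorm

/-! ### Completeness and separability -/

section Banach

open Filter Topology

variable {N : ℕ} {lam : ℝ} {ρ : EuclideanSpace ℝ (Fin N) → ℝ}

theorem coulombSeminorm_le_liminf (hN : 3 ≤ N) (hρ : AEMeasurable ρ volume)
    (hρ0 : ∀ᵐ x, 0 ≤ ρ x) {u : EuclideanSpace ℝ (Fin N) → ℝ}
    {U : ℕ → EuclideanSpace ℝ (Fin N) → ℝ}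
    (hu : AEMeasurable u volume) (hU : ∀ n, AEMeasurable (U n) volume)
    (hlim : ∀ᵐ x, Tendsto (fun n => U n x) atTop (𝓝 (u x))) :
    coulombSeminorm lam ρ u ≤ liminf (fun n => coulombSeminorm lam ρ (U n)) atTop := by
  have hac := withDensity_absolutelyContinuous (volume : Measure (EuclideanSpace ℝ (Fin N)))
    fun x => ENNReal.ofReal (ρ x)
  have h1 : coulombEnergy ρ u ≤ liminf (fun n => coulombEnergy ρ (U n)) atTop := by
    rw [coulombEnergy_eq_mixedEnergy hN hρ hρ0 hu]
    simp only [fun n => coulombEnergy_eq_mixedEnergy hN hρ hρ0 (hU n)]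
    exact mixedEnergy_le_liminf measurable_gaussianFactor (fun n => (hU n).enorm.mono_ac hac)
      (hac.ae_le (hlim.mono fun x hx => hx.enorm)) gaussianFactor_ne_top
  have hmono : Monotone fun t : ℝ≥0∞ => ENNReal.ofReal lam ^ (1 / 2 : ℝ) * t ^ (1 / 4 : ℝ) :=
    fun s t hst => by dsimp only; gcongr
  have hcont : Continuous fun t : ℝ≥0∞ => ENNReal.ofReal lam ^ (1 / 2 : ℝ) * t ^ (1 / 4 : ℝ) :=
    (ENNReal.continuous_const_mul (by finiteness)).comp ENNReal.continuous_rpow_const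
  exact (hmono h1).trans (hmono.map_liminf_of_continuousAt _ hcont.continuousAt).le

variable {X : Type*} [NormedAddCommGroup X] [NormedSpace ℝ X]

/-- `ι` identifies the normed space `X` with `E(ℝ^N)`. -/
structure IsEnergySpace (lam : ℝ) (ρ : EuclideanSpace ℝ (Fin N) → ℝ)
    (ι : X →ₗ[ℝ] (EuclideanSpace ℝ (Fin N) →ₘ[volume] ℝ)) : Prop where
  injective : Function.Injective ι
  memE : ∀ x, MemE lam ρ (ι x)
  exists_eq : ∀ u : EuclideanSpace ℝ (Fin N) →ₘ[volume] ℝ, MemE lam ρ u → ∃ x, ι x = u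
  norm_eq : ∀ x, ‖x‖ = (eNormE lam ρ (ι x)).toReal

namespace IsEnergySpace

variable {ι : X →ₗ[ℝ] (EuclideanSpace ℝ (Fin N) →ₘ[volume] ℝ)}

theorem enorm_eq (h : IsEnergySpace lam ρ ι) (x : X) : ‖x‖ₑ = eNormE lam ρ (ι x) := by
  rw [← ofReal_norm, h.norm_eq, ENNReal.ofReal_toReal (h.memE x).2.ne]

/-- The embedding of `E(ℝ^N)` into `L²`. -/
noncomputable def toL2 (h : IsEnergySpace lam ρ ι) :
    X →L[ℝ] Lp ℝ 2 (volume : Measure (EuclideanSpace ℝ (Fin N))) :=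
  LinearMap.mkContinuous
    { toFun := fun x => (h.memE x).memLp.toLp
      map_add' := fun x y => by
        rw [← MemLp.toLp_add]
        refine MemLp.toLp_congr _ _ ?_
        rw [map_add]
        exact AEEqFun.coeFn_add _ _
      map_smul' := fun c x => by
        rw [RingHom.id_apply, ← MemLp.toLp_const_smul]
        refine MemLp.toLp_congr _ _ ?_
        rw [map_smul]
        exact AEEqFun.coeFn_smul _ _ } 1 fun x => by
    rw [one_mul, h.norm_eq]
    exact (Lp.norm_toLp _ (h.memE x).memLp).trans_le (ENNReal.toReal_mono (h.memE x).2.ne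
      (eLpNorm_le_eNormE (h.memE x).aemeasurable))

/-- The weak gradient as a continuous linear map from `E(ℝ^N)` into `L²`. -/
noncomputable def gradL2 (h : IsEnergySpace lam ρ ι) :
    X →L[ℝ] Lp (EuclideanSpace ℝ (Fin N)) 2 (volume : Measure (EuclideanSpace ℝ (Fin N))) :=
  LinearMap.mkContinuous
    { toFun := fun x => (h.memE x).memLp_weakGradient.toLp
      map_add' := fun x y => by
        rw [← MemLp.toLp_add]
        refine MemLp.toLp_congr _ _ ?_
        rw [map_add]
        exact (((h.memE x).1.add (h.memE y).1).weakGradient_congr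
          (AEEqFun.coeFn_add _ _).symm).trans ((h.memE x).1.weakGradient_add (h.memE y).1)
      map_smul' := fun c x => by
        rw [RingHom.id_apply, ← MemLp.toLp_const_smul]
        refine MemLp.toLp_congr _ _ ?_
        rw [map_smul]
        exact (((h.memE x).1.const_smul c).weakGradient_congr
          (AEEqFun.coeFn_smul _ _).symm).trans ((h.memE x).1.weakGradient_const_smul c) } 1
    fun x => by
      rw [one_mul, h.norm_eq]
      exact (Lp.norm_toLp _ (h.memE x).memLp_weakGradient).trans_le
        (ENNReal.toReal_mono (h.memE x).2.ne (eLpNorm_weakGradient_le_eNormE (h.memE x).aemeasurable))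

theorem coeFn_toL2 (h : IsEnergySpace lam ρ ι) (x : X) : h.toL2 x =ᵐ[volume] ι x :=
  (h.memE x).memLp.coeFn_toLp

theorem coeFn_gradL2 (h : IsEnergySpace lam ρ ι) (x : X) :
    h.gradL2 x =ᵐ[volume] weakGradient (ι x) :=
  (h.memE x).memLp_weakGradient.coeFn_toLp

theorem toL2_injective (h : IsEnergySpace lam ρ ι) : Function.Injective h.toL2 := fun x y hxy =>
  h.injective (AEEqFun.ext ((h.coeFn_toL2 x).symm.trans (hxy ▸ h.coeFn_toL2 y)))

theorem coeFn_sub (x y : X) : ι (x - y) =ᵐ[volume] ⇑(ι x) - ⇑(ι y) := by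
  rw [map_sub]
  exact AEEqFun.coeFn_sub _ _

theorem coulombSeminorm_sub_le (h : IsEnergySpace lam ρ ι) (x y : X) :
    coulombSeminorm lam ρ (⇑(ι x) - ⇑(ι y)) ≤ ‖x - y‖ₑ := by
  rw [h.enorm_eq, coulombSeminorm, ← coulombEnergy_congr (coeFn_sub x y)]
  exact coulombSeminorm_le_eNormE (h.memE _).aemeasurable

/-- Convergence of the functions and their gradients in `L²` and convergence in the Coulomb
seminorm give convergence in `E(ℝ^N)`. -/
theorem tendsto_of (h : IsEnergySpace lam ρ ι) {x : ℕ → X} {y : X}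
    (h0 : Tendsto (fun n => h.toL2 (x n)) atTop (𝓝 (h.toL2 y)))
    (h1 : Tendsto (fun n => h.gradL2 (x n)) atTop (𝓝 (h.gradL2 y)))
    (h2 : Tendsto (fun n => coulombSeminorm lam ρ (⇑(ι (x n)) - ⇑(ι y))) atTop (𝓝 0)) :
    Tendsto x atTop (𝓝 y) := by
  have hle : ∀ n, ‖x n - y‖ₑ ≤ ‖h.gradL2 (x n) - h.gradL2 y‖ₑ + ‖h.toL2 (x n) - h.toL2 y‖ₑ +
      coulombSeminorm lam ρ (⇑(ι (x n)) - ⇑(ι y)) := fun n => by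
    rw [← map_sub, ← map_sub, h.enorm_eq, Lp.enorm_def, Lp.enorm_def,
      eLpNorm_congr_ae (h.coeFn_toL2 _), eLpNorm_congr_ae (h.coeFn_gradL2 _),
      coulombSeminorm, ← coulombEnergy_congr (coeFn_sub (x n) y)]
    exact eNormE_le_add (h.memE _).aemeasurable
  have hz : ∀ {F : Type _} [NormedAddCommGroup F] {f : ℕ → F} {b : F},
      Tendsto f atTop (𝓝 b) → Tendsto (fun n => ‖f n - b‖ₑ) atTop (𝓝 0) := fun {F _ f b} hf => by
    simpa using (hf.sub_const b).enorm
  have hlim := ((hz h1).add (hz h0)).add h2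
  simp only [add_zero] at hlim
  have := tendsto_of_tendsto_of_tendsto_of_le_of_le tendsto_const_nhds hlim
    (fun _ => zero_le) hle
  rw [tendsto_iff_edist_tendsto_0]
  simpa only [edist_eq_enorm_sub] using this

theorem exists_subseq_ae (h : IsEnergySpace lam ρ ι) {x : ℕ → X}
    {U : Lp ℝ 2 (volume : Measure (EuclideanSpace ℝ (Fin N)))}
    (hU : Tendsto (fun n => h.toL2 (x n)) atTop (𝓝 U)) :
    ∃ ns : ℕ → ℕ, StrictMono ns ∧
      ∀ᵐ z, Tendsto (fun k => ι (x (ns k)) z) atTop (𝓝 (U z)) := by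
  obtain ⟨ns, hns, hlim⟩ := (tendstoInMeasure_of_tendsto_Lp hU).exists_seq_tendsto_ae
  refine ⟨ns, hns, ?_⟩
  filter_upwards [hlim, ae_all_iff.2 fun k => h.coeFn_toL2 (x (ns k))] with z hz hz'
  simpa only [hz'] using hz

/-- The limit is found in $L^2$ together with its gradient; lower semicontinuity of the Coulomb
seminorm then shows both that the limit lies in the space and that convergence holds in the full
norm. -/
theorem completeSpace (h : IsEnergySpace lam ρ ι) (hlam : 0 < lam) (hN : 3 ≤ N)
    (hρ : AEMeasurable ρ volume) (hρ0 : ∀ᵐ x, 0 ≤ ρ x) : CompleteSpace X := by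
  refine Metric.complete_of_cauchySeq_tendsto fun x hx => ?_
  obtain ⟨U, hU⟩ := cauchySeq_tendsto_of_complete (h.toL2.uniformContinuous.comp_cauchySeq hx)
  obtain ⟨W, hW⟩ := cauchySeq_tendsto_of_complete (h.gradL2.uniformContinuous.comp_cauchySeq hx)
  obtain ⟨ns, hns, hae⟩ := h.exists_subseq_ae hU
  have hgrad : HasWeakGradient U W := HasWeakGradient.of_tendsto hU hW fun n =>
    (h.memE (x n)).1.weakGradient_spec.2.congr (h.coeFn_toL2 _).symm (h.coeFn_gradL2 _).symm
  have hUL : LocallyIntegrable U := (Lp.memLp U).locallyIntegrable (by norm_num)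
  have hWL : LocallyIntegrable W := (Lp.memLp W).locallyIntegrable (by norm_num)
  have hgradU : weakGradient U =ᵐ[volume] W := weakGradient_ae_eq hUL hWL hgrad
  have hUm : AEMeasurable U volume := (Lp.aestronglyMeasurable U).aemeasurable
  have hC : coulombEnergy ρ U ≠ ⊤ := by
    rw [← coulombSeminorm_ne_top_iff hlam]
    obtain ⟨R, -, hR⟩ := cauchySeq_bdd hx
    have hbound : ∀ n, coulombSeminorm lam ρ (ι (x n)) ≤ ‖x 0‖ₑ + ENNReal.ofReal R := fun n => by
      refine (coulombSeminorm_le_eNormE (h.memE _).aemeasurable).trans ?_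
      rw [← h.enorm_eq, ← add_sub_cancel (x 0) (x n)]
      refine (enorm_add_le _ _).trans ?_
      gcongr
      rw [← ofReal_norm, ← dist_eq_norm]
      exact ENNReal.ofReal_le_ofReal (hR n 0).le
    refine ne_top_of_le_ne_top (b := ‖x 0‖ₑ + ENNReal.ofReal R) (by finiteness) ?_
    refine (coulombSeminorm_le_liminf hN hρ hρ0 hUm
      (fun k => (h.memE (x (ns k))).aemeasurable) hae).trans ?_
    exact liminf_le_of_le (by isBoundedDefault) fun b hb =>
      (hb.exists.choose_spec).trans (hbound _)
  obtain ⟨y, hy⟩ := h.exists_eq U.1 (MemE.of_finite hlam ⟨hUL, W, hWL, hgrad⟩ (Lp.memLp U)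
    ((memLp_congr_ae hgradU).2 (Lp.memLp W)) hC)
  have hyU : h.toL2 y = U := Lp.ext ((h.coeFn_toL2 y).trans (by rw [hy]))
  have hyW : h.gradL2 y = W := Lp.ext ((h.coeFn_gradL2 y).trans (by rw [hy]; exact hgradU))
  refine ⟨y, h.tendsto_of (by rwa [hyU]) (by rwa [hyW]) ?_⟩
  rw [ENNReal.tendsto_atTop_zero]
  intro ε hε
  obtain ⟨n₀, hn₀⟩ := EMetric.cauchySeq_iff.1 hx ε hε
  refine ⟨n₀, fun n hn => ?_⟩
  -- With `n` fixed, the differences `x n - x (ns k)` tend almost everywhere to `x n - y` as `k →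
  -- ∞`, and their norms are eventually below `ε`.
  refine (coulombSeminorm_le_liminf hN hρ hρ0
    (U := fun k => ⇑(ι (x n)) - ⇑(ι (x (ns k))))
    ((h.memE _).aemeasurable.sub (h.memE _).aemeasurable)
    (fun k => (h.memE _).aemeasurable.sub (h.memE _).aemeasurable) ?_).trans ?_
  · filter_upwards [hae] with z hz
    rw [hy]
    exact tendsto_const_nhds.sub hz
  · refine liminf_le_of_le (by isBoundedDefault) fun b hb => ?_
    obtain ⟨k, hk, hkn⟩ := (hb.and (hns.tendsto_atTop.eventually_ge_atTop n₀)).exists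
    refine hk.trans ((h.coulombSeminorm_sub_le _ _).trans ?_)
    rw [← edist_eq_enorm_sub]
    exact (hn₀ n hn (ns k) hkn).le

/-- If functions and gradients converge in `L²` and the Coulomb energies converge, then a
subsequence converges in `E(ℝ^N)`. -/
theorem exists_subseq_tendsto (h : IsEnergySpace lam ρ ι) (hlam : 0 < lam) (hN : 3 ≤ N)
    (hρ : AEMeasurable ρ volume) (hρ0 : ∀ᵐ x, 0 ≤ ρ x) {x : ℕ → X} {y : X}
    (h0 : Tendsto (fun n => h.toL2 (x n)) atTop (𝓝 (h.toL2 y)))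
    (h1 : Tendsto (fun n => h.gradL2 (x n)) atTop (𝓝 (h.gradL2 y)))
    (h2 : Tendsto (fun n => coulombEnergy ρ (ι (x n))) atTop (𝓝 (coulombEnergy ρ (ι y)))) :
    ∃ ns : ℕ → ℕ, StrictMono ns ∧ Tendsto (x ∘ ns) atTop (𝓝 y) := by
  obtain ⟨ns, hns, hae'⟩ := h.exists_subseq_ae h0
  have hae : ∀ᵐ z, Tendsto (fun k => ι (x (ns k)) z) atTop (𝓝 (ι y z)) := by
    filter_upwards [hae', h.coeFn_toL2 y] with z hz hz'
    rwa [hz'] at hz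
  have hsub := hns.tendsto_atTop
  refine ⟨ns, hns, h.tendsto_of (h0.comp hsub) (h1.comp hsub) ?_⟩
  have hac := withDensity_absolutelyContinuous (volume : Measure (EuclideanSpace ℝ (Fin N)))
    fun x => ENNReal.ofReal (ρ x)
  have hm : ∀ x, AEMeasurable (ι x) volume := fun x => (h.memE x).aemeasurable
  have hyfin := (h.memE y).coulombEnergy_ne_top hlam
  have h2' := h2.comp hsub
  simp only [Function.comp_def, fun x => coulombEnergy_eq_mixedEnergy hN hρ hρ0 (hm x)]
    at h2' hyfin
  have hE : Tendsto (fun k => coulombEnergy ρ (⇑(ι (x (ns k))) - ⇑(ι y))) atTop (𝓝 0) := by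
    simp only [fun k => coulombEnergy_eq_mixedEnergy hN hρ hρ0 ((hm (x (ns k))).sub (hm y))]
    refine tendsto_mixedEnergy_zero (F := fun k z => ‖ι (x (ns k)) z‖ₑ) (f := fun z => ‖ι y z‖ₑ)
      measurable_gaussianFactor gaussianFactor_ne_top (fun k => (hm _).enorm.mono_ac hac)
      (fun k => ((hm _).sub (hm y)).enorm.mono_ac hac) ((hm y).enorm.mono_ac hac)
      (fun k z => enorm_sub_le) (hac.ae_le (hae.mono fun z hz => hz.enorm))
      (hac.ae_le (hae.mono fun z hz => ?_)) hyfin h2'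
    simpa using (hz.sub_const (ι y z)).enorm
  have hcont : Continuous fun t : ℝ≥0∞ => ENNReal.ofReal lam ^ (1 / 2 : ℝ) * t ^ (1 / 4 : ℝ) :=
    (ENNReal.continuous_const_mul (by finiteness)).comp ENNReal.continuous_rpow_const
  have := (hcont.tendsto 0).comp hE
  simpa [coulombSeminorm, Function.comp_def] using this

/-- Subsets of a second countable space are separable. The map `Φ` need be neither linear nor a
homeomorphism onto its range: recording the energy as a third coordinate is enough for
`exists_subseq_tendsto`. -/
theorem separableSpace (h : IsEnergySpace lam ρ ι) (hlam : 0 < lam) (hN : 3 ≤ N)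
    (hρ : AEMeasurable ρ volume) (hρ0 : ∀ᵐ x, 0 ≤ ρ x) : TopologicalSpace.SeparableSpace X := by
  have : Fact ((2 : ℝ≥0∞) ≠ ⊤) := ⟨by norm_num⟩
  have : SecondCountableTopology
    (Lp ℝ 2 (volume : Measure (EuclideanSpace ℝ (Fin N)))) := inferInstance
  have : SecondCountableTopology (Lp (EuclideanSpace ℝ (Fin N)) 2
    (volume : Measure (EuclideanSpace ℝ (Fin N)))) := inferInstance
  set Φ : X → Lp ℝ 2 (volume : Measure (EuclideanSpace ℝ (Fin N))) ×
    Lp (EuclideanSpace ℝ (Fin N)) 2 (volume : Measure (EuclideanSpace ℝ (Fin N))) × ℝ≥0∞ :=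
    fun x => (h.toL2 x, h.gradL2 x, coulombEnergy ρ (ι x))
  obtain ⟨t, htc, htd⟩ := TopologicalSpace.exists_countable_dense (Set.range Φ)
  -- One preimage is chosen for each point of the countable dense subset of the range.
  refine ⟨⟨(fun y : Set.range Φ => y.2.choose) '' t, htc.image _, fun y => ?_⟩⟩
  obtain ⟨w, hwt, hw⟩ := mem_closure_iff_seq_limit.1 (htd ⟨Φ y, y, rfl⟩)
  have hw' : Tendsto (fun n => Φ (w n).2.choose) atTop (𝓝 (Φ y)) := by
    simp only [fun n => (w n).2.choose_spec]
    exact (continuous_subtype_val.tendsto _).comp hw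
  obtain ⟨ns, -, hns⟩ := h.exists_subseq_tendsto hlam hN hρ hρ0
    ((continuous_fst.tendsto _).comp hw') (((continuous_fst.comp continuous_snd).tendsto _).comp hw')
    (((continuous_snd.comp continuous_snd).tendsto _).comp hw')
  exact mem_closure_of_tendsto hns
    (Eventually.of_forall fun n => Set.mem_image_of_mem _ (hwt (ns n)))

end IsEnergySpace

end Banach

/-! ### A nonzero energy space is infinite-dimensional -/

section InfiniteDimensional

open Filter Topology

variable {N : ℕ} {lam : ℝ} {ρ u : EuclideanSpace ℝ (Fin N) → ℝ}

/-- The energy space is stable under multiplication by bounded smooth functions with bounded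
gradient. -/
theorem MemE.smooth_mul (hlam : 0 < lam) (hN : 3 ≤ N) (hρ : AEMeasurable ρ volume)
    (hρ0 : ∀ᵐ x, 0 ≤ ρ x) (hu : MemE lam ρ u) {η : EuclideanSpace ℝ (Fin N) → ℝ}
    (hη : ContDiff ℝ ∞ η) {g : EuclideanSpace ℝ (Fin N) → EuclideanSpace ℝ (Fin N)}
    (hg : Continuous g) (hηg : ∀ x i, g x i = fderiv ℝ η x (EuclideanSpace.single i 1))
    {C : ℝ} (hηC : ∀ x, ‖η x‖ ≤ C) (hgC : ∀ x, ‖g x‖ ≤ C) :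
    MemE lam ρ (fun x => η x * u x) := by
  have hC0 : 0 ≤ C := (norm_nonneg _).trans (hηC 0)
  have hG := hu.memLp_weakGradient
  have hum : AEStronglyMeasurable (fun x => η x * u x) volume :=
    hη.continuous.aestronglyMeasurable.mul hu.memLp.1
  have h0 : MemLp (fun x => η x * u x) 2 :=
    hu.memLp.of_le_mul (c := C) hum (Eventually.of_forall fun x => by
      rw [norm_mul]
      exact mul_le_mul_of_nonneg_right (hηC x) (norm_nonneg _))
  have h1 : MemLp (fun x => η x • weakGradient u x) 2 :=
    hG.of_le_mul (c := C) (hη.continuous.aestronglyMeasurable.smul hG.1)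
      (Eventually.of_forall fun x => by
        rw [norm_smul]
        exact mul_le_mul_of_nonneg_right (hηC x) (norm_nonneg _))
  have h2 : MemLp (fun x => u x • g x) 2 :=
    hu.memLp.of_le_mul (c := C) (hu.memLp.1.smul hg.aestronglyMeasurable)
      (Eventually.of_forall fun x => by
        rw [norm_smul, mul_comm]
        exact mul_le_mul_of_nonneg_right (hgC x) (norm_nonneg _))
  have h12 : MemLp (fun x => η x • weakGradient u x + u x • g x) 2 := h1.add h2
  have hW : HasWeakGradient (fun x => η x * u x)
      fun x => η x • weakGradient u x + u x • g x :=
    hu.1.weakGradient_spec.2.smooth_mul hu.1.1 hu.1.weakGradient_spec.1 hη fun x i => by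
      simp [hηg]
  have hL0 := h0.locallyIntegrable (by norm_num)
  have hL1 := h12.locallyIntegrable (by norm_num)
  refine MemE.of_finite hlam ⟨hL0, _, hL1, hW⟩ h0
    ((memLp_congr_ae (weakGradient_ae_eq hL0 hL1 hW)).2 h12) ?_
  have hfin := hu.coulombEnergy_ne_top hlam
  rw [coulombEnergy_eq_mixedEnergy hN hρ hρ0 hu.aemeasurable] at hfin
  rw [coulombEnergy_eq_mixedEnergy hN hρ hρ0 hum.aemeasurable]
  refine ne_top_of_le_ne_top ?_ (mixedEnergy_mono
    (g := fun x => ENNReal.ofReal C * ‖u x‖ₑ) (Eventually.of_forall fun x => ?_))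
  · rw [mixedEnergy_const_mul measurable_gaussianFactor
      (hu.aemeasurable.enorm.mono_ac (withDensity_absolutelyContinuous _ _))
      ENNReal.ofReal_ne_top]
    finiteness
  · dsimp only
    rw [enorm_mul]
    gcongr
    rw [← ofReal_norm]
    exact ENNReal.ofReal_le_ofReal (hηC x)

/-- The arctangent of a coordinate is a bounded smooth multiplier with bounded gradient, and it is
injective in that coordinate. The constant `π` serves as a common bound for the function (`π / 2`)
and its gradient (`1`). -/
theorem MemE.arctan_mul (hlam : 0 < lam) (hN : 3 ≤ N) (hρ : AEMeasurable ρ volume)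
    (hρ0 : ∀ᵐ x, 0 ≤ ρ x) (hu : MemE lam ρ u) (j : Fin N) :
    MemE lam ρ (fun x => Real.arctan (x j) * u x) := by
  have hproj : ∀ x : EuclideanSpace ℝ (Fin N),
      HasFDerivAt (fun x : EuclideanSpace ℝ (Fin N) => x j) (EuclideanSpace.proj (𝕜 := ℝ) j) x :=
    fun x => (EuclideanSpace.proj (𝕜 := ℝ) j).hasFDerivAt
  have hd : ∀ x : EuclideanSpace ℝ (Fin N), HasFDerivAt
      (fun x : EuclideanSpace ℝ (Fin N) => Real.arctan (x j))
      ((1 / (1 + x j ^ 2)) • EuclideanSpace.proj (𝕜 := ℝ) j) x := fun x =>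
    (hproj x).arctan
  have hcont : Continuous fun x : EuclideanSpace ℝ (Fin N) => x j := by fun_prop
  have hle : ∀ t : ℝ, |1 / (1 + t ^ 2)| ≤ 1 := fun t => by
    rw [abs_of_nonneg (by positivity)]
    exact div_le_one_of_le₀ (by nlinarith [sq_nonneg t]) (by positivity)
  refine hu.smooth_mul hlam hN hρ hρ0 (η := fun x => Real.arctan (x j))
    (g := fun x => (1 / (1 + x j ^ 2)) • EuclideanSpace.single j (1 : ℝ)) (C := Real.pi)
    (Real.contDiff_arctan.comp (EuclideanSpace.proj (𝕜 := ℝ) j).contDiff) ?_ ?_ ?_ ?_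
  · refine Continuous.smul (continuous_const.div (continuous_const.add (hcont.pow 2)) fun x => ?_) continuous_const
    exact (add_pos_of_pos_of_nonneg one_pos (sq_nonneg (x j))).ne'
  · intro x i
    rw [(hd x).fderiv]
    simp [eq_comm]
  · intro x
    rw [Real.norm_eq_abs, abs_le]
    constructor <;> linarith [Real.neg_pi_div_two_lt_arctan (x j), Real.arctan_lt_pi_div_two (x j),
      Real.pi_pos]
  · intro x
    rw [norm_smul, Real.norm_eq_abs, PiLp.norm_single, norm_one, mul_one]
    linarith [hle (x j), Real.pi_gt_three]

theorem volume_coord_eq (j : Fin N) (c : ℝ) :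
    volume {x : EuclideanSpace ℝ (Fin N) | x j = c} = 0 := by
  have h := (PiLp.volume_preserving_ofLp (Fin N)).measure_preimage
    (s := {y : Fin N → ℝ | y j = c})
    (measurableSet_eq_fun (measurable_pi_apply j) measurable_const).nullMeasurableSet
  refine h.trans ?_
  rw [volume_pi]
  exact Measure.pi_hyperplane (fun _ : Fin N => (volume : Measure ℝ)) j c

namespace IsEnergySpace

variable {X : Type*} [NormedAddCommGroup X] [NormedSpace ℝ X]
  {ι : X →ₗ[ℝ] (EuclideanSpace ℝ (Fin N) →ₘ[volume] ℝ)}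

/-- A nonzero element generates, by multiplication with the powers of an injective function of one
coordinate, an infinite linearly independent family. -/
theorem not_finiteDimensional [Nontrivial X] (h : IsEnergySpace lam ρ ι) (hlam : 0 < lam)
    (hN : 3 ≤ N) (hρ : AEMeasurable ρ volume) (hρ0 : ∀ᵐ x, 0 ≤ ρ x) :
    ¬ FiniteDimensional ℝ X := by
  intro hfd
  obtain ⟨x, hx⟩ := exists_ne (0 : X)
  let j : Fin N := ⟨0, by omega⟩
  have hmem : ∀ k : ℕ, MemE lam ρ fun z => Real.arctan (z j) ^ k * ι x z := fun k => by
    induction k with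
    | zero => simpa using h.memE x
    | succ k ih =>
      have := ih.arctan_mul hlam hN hρ hρ0 j
      simpa only [pow_succ', mul_assoc] using this
  have hex : ∀ k : ℕ, ∃ y : X, ι y =ᵐ[volume] fun z => Real.arctan (z j) ^ k * ι x z := fun k => by
    have hae := AEEqFun.coeFn_mk _ (hmem k).1.1.aestronglyMeasurable
    obtain ⟨y, hy⟩ := h.exists_eq _ ((hmem k).congr hae.symm)
    exact ⟨y, by rw [hy]; exact hae⟩
  choose y hy using hex
  have hli : LinearIndependent ℝ y := by
    rw [linearIndependent_iff']
    intro s c hsum k hk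
    by_contra hck
    -- A vanishing combination of the products says that `p (arctan z_j)` times the given element is
    -- zero almost everywhere.
    set p : Polynomial ℝ := ∑ i ∈ s, Polynomial.monomial i (c i) with hp
    have hp0 : p ≠ 0 := fun h0 => hck (by
      have := congrArg (fun q => Polynomial.coeff q k) h0
      simpa [hp, Polynomial.finsetSum_coeff, Polynomial.coeff_monomial, hk] using this)
    have hsum' : (∑ i ∈ s, c i • ι (y i)) = 0 := by
      simpa [map_sum] using congrArg ι hsum
    have hz : ∀ᵐ z, p.eval (Real.arctan (z j)) * ι x z = 0 := by
      have h1 : ⇑(∑ i ∈ s, c i • ι (y i)) =ᵐ[volume] fun z => ∑ i ∈ s, c i * ι (y i) z := by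
        clear hp0 hp p hk hsum hsum'
        induction s using Finset.induction_on with
        | empty => exact AEEqFun.coeFn_zero
        | insert a s ha ih =>
          rw [Finset.sum_insert ha]
          filter_upwards [AEEqFun.coeFn_add (c a • ι (y a)) (∑ i ∈ s, c i • ι (y i)), ih,
            AEEqFun.coeFn_smul (c a) (ι (y a))] with z h1 h2 h3
          rw [h1, Pi.add_apply, h2, h3, Finset.sum_insert ha]
          rfl
      rw [hsum'] at h1
      filter_upwards [h1, AEEqFun.coeFn_zero (α := EuclideanSpace ℝ (Fin N)) (μ := volume)
        (β := ℝ), ae_all_iff.2 hy] with z hz1 hz2 hz3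
      rw [hz2] at hz1
      simp only [hz3] at hz1
      rw [hp, Polynomial.eval_finsetSum, Finset.sum_mul]
      simp only [Polynomial.eval_monomial, mul_assoc]
      exact hz1.symm
    -- A root `r = arctan z_j` forces `z_j = tan r`, so the exceptional set lies in finitely many
    -- hyperplanes. Off it the given element must vanish, contradicting `hx`.
    have hroot : ∀ᵐ z : EuclideanSpace ℝ (Fin N), p.eval (Real.arctan (z j)) ≠ 0 := by
      have hnull : volume (⋃ r ∈ p.roots.toFinset,
          {z : EuclideanSpace ℝ (Fin N) | z j = Real.tan r}) = 0 :=
        (measure_biUnion_null_iff p.roots.toFinset.countable_toSet).2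
          fun r _ => volume_coord_eq j _
      filter_upwards [compl_mem_ae_iff.2 hnull] with z hz h0
      refine hz (Set.mem_biUnion (x := Real.arctan (z j)) ?_ (Real.tan_arctan _).symm)
      simpa [hp0] using h0
    refine hx (h.injective ?_)
    rw [map_zero]
    refine AEEqFun.ext ?_
    filter_upwards [hz, hroot, AEEqFun.coeFn_zero (α := EuclideanSpace ℝ (Fin N)) (μ := volume)
      (β := ℝ)] with z h1 h2 h3
    rw [h3]
    exact (mul_eq_zero.1 h1).resolve_left h2
  exact not_finite_iff_infinite.2 (inferInstanceAs (Infinite ℕ)) hli.finite_of_isNoetherian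

end IsEnergySpace

end InfiniteDimensional

/-- `E(ℝ^N)` is a linear subspace of the space of measurable functions modulo a.e. equality, the
formula for `‖·‖_E` is a norm on it, for this norm it is complete and separable, and it has a
Markushevich basis (indexed by `ℕ`, whence the exclusion of `E = {0}` in this last assertion). -/
theorem lemma2p1 (N : ℕ) (hN : 3 ≤ N) (lam : ℝ) (hlam : 0 < lam)
    (ρ : EuclideanSpace ℝ (Fin N) → ℝ) (hρ : AEMeasurable ρ volume) (hρ0 : ∀ᵐ x, 0 ≤ ρ x) :
    ∃ E : Submodule ℝ (EuclideanSpace ℝ (Fin N) →ₘ[volume] ℝ),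
      (∀ u : EuclideanSpace ℝ (Fin N) →ₘ[volume] ℝ, u ∈ E ↔ MemE lam ρ u) ∧
      letI : Norm E := ⟨fun u => (eNormE lam ρ (u : EuclideanSpace ℝ (Fin N) →ₘ[volume] ℝ)).toReal⟩
      ∃ hnorm : NormedSpace.Core ℝ E,
        letI : NormedAddCommGroup E := NormedAddCommGroup.ofCore hnorm
        letI : NormedSpace ℝ E := NormedSpace.ofCore hnorm
        CompleteSpace E ∧ TopologicalSpace.SeparableSpace E ∧
        (Nontrivial E →
          ∃ (e : ℕ → E) (e' : ℕ → StrongDual ℝ E), IsMarkushevichBasis e e') := by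
  have hcore := energySpace_core (lam := lam) hN hρ hρ0
  refine ⟨energySpace lam hN hρ hρ0, fun u => Iff.rfl, hcore, ?_⟩
  let : Norm (energySpace lam hN hρ hρ0) :=
    ⟨fun u => (eNormE lam ρ (u : EuclideanSpace ℝ (Fin N) →ₘ[volume] ℝ)).toReal⟩
  let : NormedAddCommGroup (energySpace lam hN hρ hρ0) := NormedAddCommGroup.ofCore hcore
  let : NormedSpace ℝ (energySpace lam hN hρ hρ0) := NormedSpace.ofCore hcore
  have h : IsEnergySpace lam ρ (energySpace lam hN hρ hρ0).subtype :=
    { injective := Subtype.val_injective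
      memE := fun x => x.2
      exists_eq := fun u hu => ⟨⟨u, hu⟩, rfl⟩
      norm_eq := fun _ => rfl }
  have hsep := h.separableSpace hlam hN hρ hρ0
  exact ⟨h.completeSpace hlam hN hρ hρ0, hsep, fun _ =>
    exists_isMarkushevichBasis (h.not_finiteDimensional hlam hN hρ hρ0) h.toL2 h.toL2_injective⟩
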